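/- Let $N\ge 7$, let $B^N$ be the open unit ball of $\mathbb R^N$, and let $W\in C^1((-\infty,1];\mathbb R)$ be convex (not necessarily strictly) with $W(0)=0$ and $W(t)>0$ for all $t\in(-\infty,1]\setminus\{0\}$. For $\varepsilon>0$ let $$E_\varepsilon(u)=\int_{B^N}\Big[\tfrac12|\nabla u|^2+\tfrac1{2\varepsilon^2}W(1-|u|^2)\Big]\,dx\in[0,\infty],$$ $$\mathcal A=\{u\in H^1(B^N;\mathbb R^N):\ u(x)=x\ \text{on}\ \partial B^N\},$$ where the boundary condition means $u-\mathrm{id}\in H^1_0(B^N;\mathbb R^N)$. Then, for every $\varepsilon>0$, the following holds. There is a unique function $f_\varepsilon:[0,1]\to[0,\infty)$, continuous on $[0,1]$ and twice differentiable in $(0,1)$, such that $$-f_\varepsilon''-\frac{N-1}{r}f_\varepsilon'+\frac{N-1}{r^2}f_\varepsilon=\frac1{\varepsilon^2}f_\varepsilon\,W'(1-f_\varepsilon^2)\quad\text{for } r\in(0,1),\qquad f_\varepsilon(0)=0,\ f_\varepsilon(1)=1.$$ This $f_\varepsilon$ is positive in $(0,1)$ and strictly increasing on $[0,1]$, and the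 map $u_\varepsilon(x)=f_\varepsilon(|x|)\frac{x}{|x|}$ is the unique global minimizer of $E_\varepsilon$ in $\mathcal A$; that is, $u_\varepsilon\in\mathcal A$, $E_\varepsilon(u_\varepsilon)\le E_\varepsilon(u)$ for all $u\in\mathcal A$, and every global minimizer of $E_\varepsilon$ in $\mathcal A$ equals $u_\varepsilon$ almost everywhere in $B^N$. -/

import Mathlib

open Set MeasureTheory
open scoped ContDiff ENNReal

namespace GinzburgLandau

noncomputable section

/-- The Euclidean space `ℝ^N`. -/
abbrev Space (N : ℕ) : Type := EuclideanSpace ℝ (Fin N)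

/-- The open unit ball `B^N`. -/
abbrev unitBall (N : ℕ) : Set (Space N) := Metric.ball (0 : Space N) 1

/-- Lebesgue measure on the unit ball. -/
abbrev ballMeasure (N : ℕ) : Measure (Space N) := volume.restrict (unitBall N)

/-- The `i`-th classical partial derivative of a map on `ℝ^N`. -/
def partialDeriv {N : ℕ} {F : Type*} [NormedAddCommGroup F] [NormedSpace ℝ F]
    (i : Fin N) (φ : Space N → F) (x : Space N) : F :=
  fderiv ℝ φ x (EuclideanSpace.single i (1 : ℝ))

/-- `φ ∈ C_c^∞(B^N; F)`. -/
def IsTestMap {N : ℕ} {F : Type*} [NormedAddCommGroup F] [NormedSpace ℝ F]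
    (φ : Space N → F) : Prop :=
  ContDiff ℝ ∞ φ ∧ HasCompactSupport φ ∧ tsupport φ ⊆ unitBall N

/-- `g ∈ L²(B^N; ℝ^N)` is the `i`-th weak partial derivative of `u` in `B^N`. -/
def IsWeakPartial {N : ℕ} (i : Fin N) (u g : Space N → Space N) : Prop :=
  MemLp g 2 (ballMeasure N) ∧
    ∀ φ : Space N → ℝ, IsTestMap φ →
      ∫ x in unitBall N, partialDeriv i φ x • u x = -∫ x in unitBall N, φ x • g x

/-- `u ∈ H¹(B^N; ℝ^N)`. -/
def MemH1 {N : ℕ} (u : Space N → Space N) : Prop :=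
  MemLp u 2 (ballMeasure N) ∧ ∀ i : Fin N, ∃ g : Space N → Space N, IsWeakPartial i u g

open Classical in
/-- The `i`-th weak partial derivative of a map in `H¹(B^N; ℝ^N)` (determined a.e. in `B^N`). -/
def weakPartial {N : ℕ} (i : Fin N) (u : Space N → Space N) : Space N → Space N :=
  if h : ∃ g : Space N → Space N, IsWeakPartial i u g then h.choose else 0

/-- `v ∈ H¹₀(B^N; ℝ^N)`: `v` lies in the closure of `C_c^∞(B^N; ℝ^N)` in `H¹(B^N; ℝ^N)`. -/
def MemH10 {N : ℕ} (v : Space N → Space N) : Prop :=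
  MemH1 v ∧ ∀ δ : ℝ≥0∞, 0 < δ → ∃ φ : Space N → Space N, IsTestMap φ ∧
    eLpNorm (fun x => v x - φ x) 2 (ballMeasure N) < δ ∧
    ∀ i : Fin N,
      eLpNorm (fun x => weakPartial i v x - partialDeriv i φ x) 2 (ballMeasure N) < δ

/-- The admissible class: `u ∈ H¹(B^N; ℝ^N)` with `u(x) = x` on `∂B^N`, the boundary condition
being `u - id ∈ H¹₀(B^N; ℝ^N)`. -/
def Admissible {N : ℕ} (u : Space N → Space N) : Prop :=
  MemH1 u ∧ MemH10 (fun x => u x - x)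

/-- The potentials: `W ∈ C¹((-∞,1])` convex, `W(0) = 0`, and `W > 0` on `(-∞,1] \ {0}`.
Only the restriction of `W` to `(-∞,1]` matters. -/
structure IsPotential (W : ℝ → ℝ) : Prop where
  contDiffOn : ContDiffOn ℝ 1 W (Iic 1)
  convexOn : ConvexOn ℝ (Iic 1) W
  zero : W 0 = 0
  pos : ∀ t ∈ Iic (1 : ℝ), t ≠ 0 → 0 < W t

/-- The energy `E_ε(u) = ∫_{B^N} [½ |∇u|² + (1/(2ε²)) W(1 - |u|²)] dx`, with `|∇u|²` the sum of
the squares of all first derivatives of all components. Its integrand is nonnegative when `W ≥ 0`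
on `(-∞,1]`, so the energy is a value in `[0,∞]`. -/
def energy {N : ℕ} (W : ℝ → ℝ) (ε : ℝ) (u : Space N → Space N) : ℝ≥0∞ :=
  ∫⁻ x in unitBall N, ENNReal.ofReal
    (1 / 2 * ∑ i : Fin N, ‖weakPartial i u x‖ ^ 2 + 1 / (2 * ε ^ 2) * W (1 - ‖u x‖ ^ 2))

/-- `u` is a global minimizer of `E_ε` in the admissible class. -/
def IsGlobalMinimizer {N : ℕ} (W : ℝ → ℝ) (ε : ℝ) (u : Space N → Space N) : Prop :=
  Admissible u ∧ ∀ v : Space N → Space N, Admissible v → energy W ε u ≤ energy W ε v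

/-- `f : [0,1] → [0,∞)` is a solution, continuous on `[0,1]` and twice differentiable in `(0,1)`,
of `-f'' - (N-1)/r f' + (N-1)/r² f = (1/ε²) f W'(1 - f²)` in `(0,1)`, `f(0) = 0`, `f(1) = 1`. -/
structure IsRadialProfile (N : ℕ) (W : ℝ → ℝ) (ε : ℝ) (f : ℝ → ℝ) : Prop where
  continuousOn : ContinuousOn f (Icc 0 1)
  nonneg : ∀ r ∈ Icc (0 : ℝ) 1, 0 ≤ f r
  differentiableAt : ∀ r ∈ Ioo (0 : ℝ) 1, DifferentiableAt ℝ f r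
  differentiableAt_deriv : ∀ r ∈ Ioo (0 : ℝ) 1, DifferentiableAt ℝ (deriv f) r
  ode : ∀ r ∈ Ioo (0 : ℝ) 1,
    -deriv (deriv f) r - ((N : ℝ) - 1) / r * deriv f r + ((N : ℝ) - 1) / r ^ 2 * f r
      = 1 / ε ^ 2 * f r * derivWithin W (Iic 1) (1 - f r ^ 2)
  left : f 0 = 0
  right : f 1 = 1

/-- The radially symmetric map `x ↦ f(|x|) x/|x|` (with value `0` at the origin). -/
def radialMap {N : ℕ} (f : ℝ → ℝ) (x : Space N) : Space N :=
  (f ‖x‖ / ‖x‖) • x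

end

end GinzburgLandau

namespace GinzburgLandau

open Filter Topology
open scoped RealInnerProductSpace

/-! Write the profile as `f(r) = r q(r)`, put `U(x) = q(|x|) x`, `A = q'/r` and `V(r) = W'(1 -
f²)/ε²`. For admissible `u` set `v = u - U`, which lies in `H¹₀`. Convexity of `W` bounds `W(1 -
|u|²)` below by its tangent line at `1 - |U|²`, and expanding the squares gives `E(u) - E(U) ≥ [∫
∇U·∇v - V U·v] + ½ ∫ (|∇v|² - V |v|²)`. The first bracket vanishes by the Euler–Lagrange equation
(`RegularProfile.euler_lagrange`). Minimality and uniqueness both follow once `∫ |∇v|² ≥ ∫ (V +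
κ)|v|²` for some `κ > 0` (`RegularProfile.coercive`).

Coercivity is where `N ≥ 7` enters. The function `q` is almost a positive solution of `-Δψ = Vψ` in
dimension `N`: in fact `-Δq = Vq + 2A`, with `A ≤ 0` and, since `f' ≥ 0`, `r² A ≥ -q`. The loss `2A`
is of Hardy size `1/r²`, and multiplying `q` by `(r² + d)^(-3/4)` makes up for it, giving `-Δψ ≥ (V
+ κ)ψ`. A positive supersolution yields the inequality by completing a square. Both facts are proved
for test maps and carried over to `H¹₀` by density.

The profile is found by shooting in `q(0)`. As `W'` is only continuous, the initial value problem
may lack uniqueness, so a small delay is put into the nonlinearity, making the solution an explicit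
continuous function of `q(0)`; the delay is then removed by compactness
(`exists_profile_integral_equation`). Monotonicity of `f` compares the equation at an interior
maximum and a later interior minimum (`SolvesRadial.strictMonoOn`). Uniqueness of the profile comes
from a maximum principle for the ratio of two solutions (`SolvesRadial.eqOn`). -/

/-! ### Integration by parts and the radial divergence theorem on the ball. -/

instance isFiniteMeasure_ballMeasure (N : ℕ) : IsFiniteMeasure (ballMeasure N) :=
  ⟨by rw [Measure.restrict_apply_univ]; exact measure_ball_lt_top⟩

/-- A continuous function is bounded on the unit ball, hence square integrable there. -/
theorem memLp_ball_of_continuous {N : ℕ} {F : Type*} [NormedAddCommGroup F]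
    {u : Space N → F} (hu : Continuous u) (p : ℝ≥0∞) : MemLp u p (ballMeasure N) := by
  have hK : IsCompact (Metric.closedBall (0 : Space N) 1) := isCompact_closedBall _ _
  obtain ⟨C, hC⟩ := hK.exists_bound_of_continuousOn hu.continuousOn
  refine MemLp.of_bound (C := C) ?_ ?_
  · exact hu.aestronglyMeasurable
  · filter_upwards [ae_restrict_mem Metric.isOpen_ball.measurableSet] with x hx
    exact hC x (Metric.ball_subset_closedBall hx)

theorem integrableOn_ball_of_continuous {N : ℕ} {F : Type*} [NormedAddCommGroup F]
    {u : Space N → F} (hu : Continuous u) : IntegrableOn u (unitBall N) :=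
  memLp_one_iff_integrable.1 (memLp_ball_of_continuous hu 1)

/-- Integration by parts against a compactly supported scalar function. -/
theorem integral_ball_partialDeriv_smul {N : ℕ} {F : Type*} [NormedAddCommGroup F]
    [NormedSpace ℝ F] {s : Space N → ℝ} (hs : ContDiff ℝ 1 s)
    (hsupp : tsupport s ⊆ unitBall N) {X : Space N → F} {X' : Space N → Space N →L[ℝ] F}
    (hX : ∀ x ∈ unitBall N, HasFDerivAt X (X' x) x) (i : Fin N)
    (hXi : IntegrableOn X (unitBall N))
    (hX'i : IntegrableOn (fun x => X' x (EuclideanSpace.single i (1 : ℝ))) (unitBall N)) :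
    ∫ x in unitBall N, partialDeriv i s x • X x
      = -∫ x in unitBall N, s x • X' x (EuclideanSpace.single i (1 : ℝ)) := by
  have hz : ∀ x, x ∉ unitBall N → s x = 0 := fun x hx =>
    image_eq_zero_of_notMem_tsupport fun h => hx (hsupp h)
  have hz' : ∀ x, x ∉ unitBall N → fderiv ℝ s x = 0 := fun x hx =>
    image_eq_zero_of_notMem_tsupport fun h => hx (hsupp (tsupport_fderiv_subset ℝ h))
  have hcs : Continuous s := hs.continuous
  have hcs' : Continuous fun x => fderiv ℝ s x (EuclideanSpace.single i (1 : ℝ)) :=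
    (hs.continuous_fderiv one_ne_zero).clm_apply continuous_const
  have hbdd : ∀ {c : Space N → ℝ}, Continuous c → (∀ x, x ∉ unitBall N → c x = 0) →
      ∀ {Y : Space N → F}, IntegrableOn Y (unitBall N) →
      Integrable fun x => c x • Y x := by
    intro c hc hc0 Y hY
    have : IntegrableOn (fun x => c x • Y x) (unitBall N) := by
      obtain ⟨C, hC⟩ := (isCompact_closedBall (0 : Space N) 1).exists_bound_of_continuousOn
        hc.continuousOn
      refine Integrable.bdd_smul hY C hc.aestronglyMeasurable ?_
      filter_upwards [ae_restrict_mem Metric.isOpen_ball.measurableSet] with x hx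
      exact hC x (Metric.ball_subset_closedBall hx)
    rw [← integrableOn_iff_integrable_of_support_subset (s := unitBall N)]
    · exact this
    · intro x hx
      by_contra h
      exact hx (by simp [hc0 x h])
  have key := integral_bilinear_hasFDerivAt_right_eq_neg_left_of_integrable
    (μ := (volume : Measure (Space N))) (f := s) (f' := fderiv ℝ s) (g := X) (g' := X')
    (v := EuclideanSpace.single i (1 : ℝ)) (B := ContinuousLinearMap.lsmul ℝ ℝ)
    (by simpa using hbdd hcs' (fun x hx => by simp [hz' x hx]) hXi)
    (by simpa using hbdd hcs hz hX'i)
    (by simpa using hbdd hcs hz hXi)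
    (fun x _ => (hs.differentiable one_ne_zero x).hasFDerivAt)
    (fun x hx => hX x (hsupp hx))
  simp only [ContinuousLinearMap.lsmul_apply] at key
  rw [setIntegral_eq_integral_of_forall_compl_eq_zero
      (fun x hx => by simp [partialDeriv, hz' x hx]),
    setIntegral_eq_integral_of_forall_compl_eq_zero
      (fun x hx => by rw [hz x hx, zero_smul]), key]
  simp [partialDeriv]

theorem hasFDerivAt_comp_norm {N : ℕ} {g : ℝ → ℝ} {d : ℝ} {x : Space N} (hx : x ≠ 0)
    (hg : HasDerivAt g (d / ‖x‖) ‖x‖) :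
    HasFDerivAt (fun x : Space N => g ‖x‖) ((d / ‖x‖ ^ 2) • innerSL ℝ x) x := by
  have hpos : 0 < ‖x‖ := norm_pos_iff.2 hx
  have h1 : HasFDerivAt (fun x : Space N => ‖x‖) ((1 / ‖x‖) • innerSL ℝ x) x := by
    have h := (hasStrictFDerivAt_norm_sq x).hasFDerivAt.sqrt (by positivity)
    simp only [Real.sqrt_sq (norm_nonneg _)] at h
    refine h.congr_fderiv ?_
    ext y
    simp
    field_simp
  refine (hg.comp_hasFDerivAt x h1).congr_fderiv ?_
  ext y
  simp
  field_simp

/-- The derivative of a radial vector field `x ↦ g(|x|) x`, where `g' = D/r`. -/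
theorem hasFDerivAt_radial {N : ℕ} {g D : ℝ → ℝ} (hg : Continuous g)
    (hg' : ∀ r ∈ Ioo (0 : ℝ) 1, HasDerivAt g (D r / r) r) {x : Space N} (hx : x ∈ unitBall N) :
    HasFDerivAt (fun x : Space N => g ‖x‖ • x)
      (g ‖x‖ • ContinuousLinearMap.id ℝ (Space N) +
        ((D ‖x‖ / ‖x‖ ^ 2) • innerSL ℝ x).smulRight x) x := by
  rcases eq_or_ne x 0 with rfl | hx0
  · simp only [norm_zero, map_zero, smul_zero, ContinuousLinearMap.smulRight_zero, add_zero]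
    rw [hasFDerivAt_iff_isLittleO_nhds_zero]
    -- At the origin continuity of `g` is enough: `g(|h|) h - g(0) h = o(h)`.
    have h1 : (fun h : Space N => g ‖h‖ - g 0) =o[𝓝 0] (fun _ => (1 : ℝ)) := by
      rw [Asymptotics.isLittleO_one_iff]
      have : Continuous fun h : Space N => g ‖h‖ - g 0 := by fun_prop
      simpa using this.tendsto 0
    have h2 := h1.smul_isBigO (Asymptotics.isBigO_refl (fun h : Space N => h) (𝓝 0))
    simp only [one_smul] at h2
    refine h2.congr_left fun h => ?_
    simp [sub_smul]
  · have hpos : 0 < ‖x‖ := norm_pos_iff.2 hx0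
    have h := hasFDerivAt_comp_norm hx0 (hg' ‖x‖ ⟨hpos, by simpa using hx⟩)
    exact h.smul (hasFDerivAt_id x)

theorem sum_inner_single {N : ℕ} (x : Space N) (L : Space N →L[ℝ] ℝ) :
    ∑ i, x i * L (EuclideanSpace.single i (1 : ℝ)) = L x := by
  conv_rhs => rw [← (EuclideanSpace.basisFun (Fin N) ℝ).sum_repr x]
  simp [map_sum]

/-- The divergence theorem for the compactly supported radial vector field `s(x) g(|x|) x`. -/
theorem integral_ball_radial_divergence {N : ℕ} {g D : ℝ → ℝ} (hg : Continuous g)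
    (hD : Continuous D) (hg' : ∀ r ∈ Ioo (0 : ℝ) 1, HasDerivAt g (D r / r) r)
    (hD0 : D 0 = 0) {s : Space N → ℝ} (hs : ContDiff ℝ 1 s) (hsupp : tsupport s ⊆ unitBall N) :
    ∫ x in unitBall N, g ‖x‖ * fderiv ℝ s x x
      = -∫ x in unitBall N, s x * (N * g ‖x‖ + D ‖x‖) := by
  have hcs : Continuous s := hs.continuous
  have hcs' : ∀ i, Continuous fun x => fderiv ℝ s x (EuclideanSpace.single i (1 : ℝ)) :=
    fun i => (hs.continuous_fderiv one_ne_zero).clm_apply continuous_const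
  -- The quotient `x_i²/|x|²` has no limit at the origin, but it is measurable and bounded by 1.
  have hq : ∀ i, Integrable (fun x : Space N => (x i ^ 2 / ‖x‖ ^ 2) * D ‖x‖) (ballMeasure N) := by
    intro i
    have h1 : IntegrableOn (fun x : Space N => D ‖x‖) (unitBall N) :=
      integrableOn_ball_of_continuous (by fun_prop)
    refine Integrable.bdd_mul (c := 1) h1 ?_ ?_
    · exact Measurable.aestronglyMeasurable (by fun_prop)
    · refine Eventually.of_forall fun x => ?_
      rw [Real.norm_of_nonneg (by positivity)]
      refine div_le_one_of_le₀ ?_ (by positivity)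
      rw [EuclideanSpace.norm_sq_eq]
      simpa using Finset.single_le_sum (f := fun j => x j ^ 2) (fun j _ => sq_nonneg _)
        (Finset.mem_univ i)
  have hX' : ∀ i, IntegrableOn (fun x : Space N => g ‖x‖ + (x i ^ 2 / ‖x‖ ^ 2) * D ‖x‖)
      (unitBall N) := fun i =>
    (integrableOn_ball_of_continuous (u := fun x : Space N => g ‖x‖) (by fun_prop)).add (hq i)
  have key : ∀ i : Fin N, ∫ x in unitBall N, partialDeriv i s x • (g ‖x‖ * x i)
      = -∫ x in unitBall N, s x • (g ‖x‖ + (x i ^ 2 / ‖x‖ ^ 2) * D ‖x‖) := by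
    intro i
    have e : ∀ x : Space N, (((EuclideanSpace.proj i : Space N →L[ℝ] ℝ)).comp
        (g ‖x‖ • ContinuousLinearMap.id ℝ (Space N) +
        ((D ‖x‖ / ‖x‖ ^ 2) • innerSL ℝ x).smulRight x)) (EuclideanSpace.single i (1 : ℝ))
          = g ‖x‖ + (x i ^ 2 / ‖x‖ ^ 2) * D ‖x‖ := by
      intro x
      simp [EuclideanSpace.inner_single_right]
      ring
    have h := integral_ball_partialDeriv_smul hs hsupp (i := i)
      (X := fun x : Space N => g ‖x‖ * x i)
      (fun x hx => ((EuclideanSpace.proj i : Space N →L[ℝ] ℝ)).hasFDerivAt.comp x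
        (hasFDerivAt_radial hg hg' hx))
      (integrableOn_ball_of_continuous (by fun_prop)) (by simpa only [e] using hX' i)
    simpa only [e] using h
  have hl : ∀ i : Fin N, Integrable (fun x : Space N => partialDeriv i s x • (g ‖x‖ * x i))
      (ballMeasure N) := fun i =>
    integrableOn_ball_of_continuous ((hcs' i).smul (by fun_prop))
  have hr : ∀ i : Fin N, Integrable
      (fun x : Space N => s x • (g ‖x‖ + (x i ^ 2 / ‖x‖ ^ 2) * D ‖x‖)) (ballMeasure N) := by
    intro i
    obtain ⟨C, hC⟩ := (isCompact_closedBall (0 : Space N) 1).exists_bound_of_continuousOn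
      hcs.continuousOn
    refine Integrable.bdd_smul (hX' i) C hcs.aestronglyMeasurable ?_
    filter_upwards [ae_restrict_mem Metric.isOpen_ball.measurableSet] with x hx
    exact hC x (Metric.ball_subset_closedBall hx)
  have hsum := Finset.sum_congr (rfl : (Finset.univ : Finset (Fin N)) = _) fun i _ => key i
  rw [← integral_finsetSum _ fun i _ => hl i, Finset.sum_neg_distrib,
    ← integral_finsetSum _ fun i _ => hr i] at hsum
  have e1 : ∀ x : Space N, ∑ i, partialDeriv i s x • (g ‖x‖ * x i) = g ‖x‖ * fderiv ℝ s x x := by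
    intro x
    rw [← sum_inner_single x (fderiv ℝ s x), Finset.mul_sum]
    refine Finset.sum_congr rfl fun i _ => ?_
    simp only [partialDeriv, smul_eq_mul]; ring
  have e2 : ∀ x : Space N, ∑ i, s x • (g ‖x‖ + (x i ^ 2 / ‖x‖ ^ 2) * D ‖x‖)
      = s x * (N * g ‖x‖ + D ‖x‖) := by
    intro x
    simp only [smul_eq_mul, ← Finset.mul_sum, Finset.sum_add_distrib, Finset.sum_const,
      Finset.card_univ, Fintype.card_fin, nsmul_eq_mul, ← Finset.sum_mul, ← Finset.sum_div]
    congr 2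
    -- At the origin the quotient is `0/0 = 0` rather than summing to 1; `D 0 = 0` keeps the
    -- identity true there.
    rcases eq_or_ne x 0 with rfl | hx
    · simp [hD0]
    · have : ∑ i, x i ^ 2 = ‖x‖ ^ 2 := by rw [EuclideanSpace.norm_sq_eq]; simp
      rw [this, div_self (by simpa using hx), one_mul]
  simpa only [e1, e2] using hsum

/-! ### Weak derivatives -/

theorem isWeakPartial_of_hasFDerivAt {N : ℕ} {u : Space N → Space N}
    {u' : Space N → Space N →L[ℝ] Space N} (hu : Continuous u)
    (hu' : ∀ x ∈ unitBall N, HasFDerivAt u (u' x) x) (i : Fin N)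
    (hmem : MemLp (fun x => u' x (EuclideanSpace.single i (1 : ℝ))) 2 (ballMeasure N)) :
    IsWeakPartial i u (fun x => u' x (EuclideanSpace.single i (1 : ℝ))) :=
  ⟨hmem, fun _ hφ => integral_ball_partialDeriv_smul (hφ.1.of_le (by simp)) hφ.2.2 hu' i
    (integrableOn_ball_of_continuous hu) (hmem.integrable (by norm_num))⟩

/-- Fundamental lemma of the calculus of variations. It makes `weakPartial`, which is picked by
choice, computable almost everywhere. -/
theorem IsWeakPartial.ae_eq {N : ℕ} {i : Fin N} {u v g h : Space N → Space N}
    (huv : u =ᵐ[ballMeasure N] v) (hg : IsWeakPartial i u g) (hh : IsWeakPartial i v h) :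
    g =ᵐ[ballMeasure N] h := by
  have hint : IntegrableOn (fun x => g x - h x) (unitBall N) :=
    (hg.1.sub hh.1).integrable (by norm_num)
  have key := Metric.isOpen_ball.ae_eq_zero_of_integral_contDiff_smul_eq_zero
    (μ := (volume : Measure (Space N))) (U := unitBall N) hint.locallyIntegrableOn ?_
  · rw [EventuallyEq, ae_restrict_iff' Metric.isOpen_ball.measurableSet]
    filter_upwards [key] with x hx hxU using sub_eq_zero.1 (hx hxU)
  · intro φ h1 h2 h3
    have hφ : IsTestMap φ := ⟨h1, h2, h3⟩
    have hb : ∀ {Y : Space N → Space N}, MemLp Y 2 (ballMeasure N) →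
        Integrable (fun x => φ x • Y x) (ballMeasure N) := fun hY => by
      have := (hY.integrable (by norm_num)).smul_of_top_right
        (memLp_ball_of_continuous h1.continuous ⊤)
      exact this
    have e1 := hg.2 φ hφ
    have e2 := hh.2 φ hφ
    have e3 : ∫ x in unitBall N, partialDeriv i φ x • u x
        = ∫ x in unitBall N, partialDeriv i φ x • v x :=
      integral_congr_ae (by filter_upwards [huv] with x hx using by rw [hx])
    have e4 : ∫ x in unitBall N, φ x • g x = ∫ x in unitBall N, φ x • h x :=
      neg_injective (by rw [← e1, ← e2, e3])
    have e5 : ∫ x in unitBall N, φ x • (g x - h x) = 0 := by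
      simp_rw [smul_sub]
      rw [integral_sub (hb hg.1) (hb hh.1), e4, sub_self]
    rwa [setIntegral_eq_integral_of_forall_compl_eq_zero] at e5
    intro x hx
    rw [image_eq_zero_of_notMem_tsupport fun h => hx (h3 h), zero_smul]

theorem MemH1.isWeakPartial {N : ℕ} {u : Space N → Space N} (hu : MemH1 u) (i : Fin N) :
    IsWeakPartial i u (weakPartial i u) := by
  rw [weakPartial, dif_pos (hu.2 i)]
  exact (hu.2 i).choose_spec

theorem IsWeakPartial.sub {N : ℕ} {i : Fin N} {u v g h : Space N → Space N}
    (hu : MemLp u 2 (ballMeasure N)) (hv : MemLp v 2 (ballMeasure N))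
    (hg : IsWeakPartial i u g) (hh : IsWeakPartial i v h) :
    IsWeakPartial i (fun x => u x - v x) (fun x => g x - h x) := by
  refine ⟨hg.1.sub hh.1, fun φ hφ => ?_⟩
  have hc : Continuous fun x => partialDeriv i φ x :=
    (hφ.1.continuous_fderiv (by simp)).clm_apply continuous_const
  have hb : ∀ {c : Space N → ℝ}, Continuous c → ∀ {Y : Space N → Space N},
      MemLp Y 2 (ballMeasure N) → Integrable (fun x => c x • Y x) (ballMeasure N) :=
    fun hc _ hY => (hY.integrable (by norm_num)).smul_of_top_right
      (memLp_ball_of_continuous hc ⊤)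
  simp_rw [smul_sub]
  rw [integral_sub (hb hc hu) (hb hc hv), integral_sub (hb hφ.1.continuous hg.1)
    (hb hφ.1.continuous hh.1), hg.2 φ hφ, hh.2 φ hφ]
  abel

/-! ### Existence of the radial profile -/

/-- The nonlinearity `q⁺ w(tq)` of the equation for `q(t) = f(t)/t`. -/
def source (w : ℝ → ℝ) (t q : ℝ) : ℝ := max q 0 * w (t * q)

/-- The weighted average `∫₀¹ τⁿ k(τ s) dτ`. -/
noncomputable def radialAvg (n : ℕ) (k : ℝ → ℝ) (s : ℝ) : ℝ := ∫ τ in (0 : ℝ)..1, τ ^ n * k (τ * s)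

theorem continuous_source {w : ℝ → ℝ} (hw : Continuous w) :
    Continuous (fun z : ℝ × ℝ => source w z.1 z.2) := by
  unfold source; fun_prop

theorem source_nonneg {w : ℝ → ℝ} (hw0 : ∀ x, 0 ≤ w x) (t q : ℝ) : 0 ≤ source w t q :=
  mul_nonneg (le_max_right _ _) (hw0 _)

/-- Either `tq ≤ 1`, or `w(tq) = 0`. The bound does not depend on `q`, so every approximate profile
gets the same Lipschitz constant `M`. -/
theorem mul_source_le {w : ℝ → ℝ} {M : ℝ} (hw0 : ∀ x, 0 ≤ w x) (hwM : ∀ x, w x ≤ M)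
    (hw1 : ∀ x, 1 ≤ x → w x = 0) (t q : ℝ) : t * source w t q ≤ M := by
  have hM : 0 ≤ M := (hw0 0).trans (hwM 0)
  unfold source
  rcases le_total q 0 with hq | hq
  · simpa [max_eq_right hq] using hM
  · rw [max_eq_left hq, ← mul_assoc]
    rcases le_total 1 (t * q) with h | h
    · simpa [hw1 _ h] using hM
    · calc t * q * w (t * q) ≤ 1 * w (t * q) := by gcongr; exact hw0 _
        _ ≤ M := by simpa using hwM _

/-- One factor `τ` of `τⁿ` joins `s` to form the argument `t = τ s`, so that the bound on `t k(t)`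
applies; this is why `n ≠ 0`. -/
theorem mul_radialAvg_mem {n : ℕ} (hn : n ≠ 0) {k : ℝ → ℝ} (hk : Continuous k) {M : ℝ}
    (hk0 : ∀ t, 0 ≤ t → 0 ≤ k t) (hkM : ∀ t, 0 ≤ t → t * k t ≤ M) {s : ℝ} (hs : 0 ≤ s) :
    s * radialAvg n k s ∈ Icc 0 M := by
  obtain ⟨m, rfl⟩ := Nat.exists_eq_succ_of_ne_zero hn
  constructor
  · refine mul_nonneg hs (intervalIntegral.integral_nonneg zero_le_one fun τ hτ => ?_)
    exact mul_nonneg (pow_nonneg hτ.1 _) (hk0 _ (mul_nonneg hτ.1 hs))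
  · have hM : 0 ≤ M := by simpa using hkM 0 le_rfl
    rw [radialAvg, ← intervalIntegral.integral_const_mul]
    calc ∫ τ in (0 : ℝ)..1, s * (τ ^ (m + 1) * k (τ * s)) ≤ ∫ τ in (0 : ℝ)..1, M := by
          refine intervalIntegral.integral_mono_on zero_le_one
            (Continuous.intervalIntegrable (by fun_prop) _ _)
            (Continuous.intervalIntegrable (by fun_prop) _ _) fun τ hτ => ?_
          calc s * (τ ^ (m + 1) * k (τ * s)) = τ ^ m * ((τ * s) * k (τ * s)) := by ring
            _ ≤ 1 * M := by
              gcongr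
              · exact mul_nonneg (mul_nonneg hτ.1 hs) (hk0 _ (mul_nonneg hτ.1 hs))
              · exact pow_le_one₀ hτ.1 hτ.2
              · exact hkM _ (mul_nonneg hτ.1 hs)
            _ = M := one_mul M
      _ = M := by simp

theorem continuous_radialAvg {X : Type*} [TopologicalSpace X] {n : ℕ} {k : X → ℝ → ℝ}
    (hk : Continuous (Function.uncurry k)) :
    Continuous (fun z : X × ℝ => radialAvg n (k z.1) z.2) := by
  unfold radialAvg
  refine intervalIntegral.continuous_parametric_intervalIntegral_of_continuous' ?_ 0 1
  have : Continuous fun p : (X × ℝ) × ℝ => Function.uncurry k (p.1.1, p.2 * p.1.2) :=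
    hk.comp (by fun_prop)
  simp only [Function.uncurry_apply_pair] at this
  simp only [Function.uncurry_def]
  fun_prop

theorem continuous_mul_radialAvg {n : ℕ} {k : ℝ → ℝ} (hk : Continuous k) :
    Continuous fun s => s * radialAvg n k s :=
  continuous_id.mul ((continuous_radialAvg (X := Unit) (k := fun _ => k)
    (hk.comp continuous_snd)).comp (Continuous.prodMk_right ()))

theorem sub_mem_of_primitive {n : ℕ} (hn : n ≠ 0) {k : ℝ → ℝ} (hk : Continuous k) {M : ℝ}
    (hk0 : ∀ t, 0 ≤ t → 0 ≤ k t) (hkM : ∀ t, 0 ≤ t → t * k t ≤ M) {r r' : ℝ} (hr : 0 ≤ r)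
    (hrr' : r ≤ r') :
    (∫ s in (0 : ℝ)..r', s * radialAvg n k s) - (∫ s in (0 : ℝ)..r, s * radialAvg n k s)
      ∈ Icc 0 (M * (r' - r)) := by
  have hc := continuous_mul_radialAvg (n := n) hk
  rw [intervalIntegral.integral_interval_sub_left (hc.intervalIntegrable _ _)
    (hc.intervalIntegrable _ _)]
  have hm : ∀ s ∈ Icc r r', s * radialAvg n k s ∈ Icc 0 M := fun s hs =>
    mul_radialAvg_mem hn hk hk0 hkM (hr.trans hs.1)
  constructor
  · exact intervalIntegral.integral_nonneg hrr' fun s hs => (hm s hs).1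
  · calc ∫ s in r..r', s * radialAvg n k s ≤ ∫ s in r..r', M :=
          intervalIntegral.integral_mono_on hrr' (hc.intervalIntegrable _ _)
            (Continuous.intervalIntegrable (by fun_prop) _ _) fun s hs => (hm s hs).2
      _ = M * (r' - r) := by simp [mul_comm]

/-- The iterates for the equation with the argument of the nonlinearity delayed by `δ`. -/
noncomputable def delayIter (n : ℕ) (w : ℝ → ℝ) (δ : ℝ) : ℕ → ℝ → ℝ → ℝ
  | 0, a, _ => a
  | k + 1, a, r => a - ∫ s in (0 : ℝ)..r, s * radialAvg n
      (fun t => source w t (delayIter n w δ k a (max (t - δ) 0))) s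

theorem continuous_delayIter {n : ℕ} {w : ℝ → ℝ} (hw : Continuous w) (δ : ℝ) (k : ℕ) :
    Continuous (fun z : ℝ × ℝ => delayIter n w δ k z.1 z.2) := by
  induction k with
  | zero => exact continuous_fst
  | succ k ih =>
    simp only [delayIter]
    refine continuous_fst.sub ?_
    have h1 : Continuous (Function.uncurry fun a t : ℝ =>
        source w t (delayIter n w δ k a (max (t - δ) 0))) := by
      have h0 : Continuous fun z : ℝ × ℝ => delayIter n w δ k z.1 (max (z.2 - δ) 0) :=
        ih.comp (f := fun z : ℝ × ℝ => (z.1, max (z.2 - δ) 0)) (by fun_prop)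
      exact (continuous_source hw).comp (continuous_snd.prodMk h0)
    have h2 := continuous_radialAvg (n := n) h1
    have h3 : Continuous (Function.uncurry fun (z : ℝ × ℝ) (s : ℝ) => s * radialAvg n
        (fun t => source w t (delayIter n w δ k z.1 (max (t - δ) 0))) s) :=
      continuous_snd.mul (h2.comp (f := fun p : (ℝ × ℝ) × ℝ => (p.1.1, p.2)) (by fun_prop))
    exact intervalIntegral.continuous_parametric_intervalIntegral_of_continuous
      (a₀ := 0) h3 continuous_snd

/-- Method of steps: on `[0, (k+1)δ]` the right-hand side reads the previous iterate only on `[0,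
kδ]`, so each iteration settles one more interval of length `δ`. -/
theorem delayIter_succ_eq {n : ℕ} {w : ℝ → ℝ} {δ : ℝ} (hδ : 0 < δ) (a : ℝ) (k : ℕ) :
    ∀ r ∈ Icc 0 (k * δ), delayIter n w δ (k + 1) a r = delayIter n w δ k a r := by
  induction k with
  | zero =>
    intro r hr
    have : r = 0 := le_antisymm (by simpa using hr.2) hr.1
    simp [delayIter, this]
  | succ k ih =>
    intro r hr
    rw [delayIter, delayIter]
    congr 1
    refine intervalIntegral.integral_congr fun s hs => ?_
    rw [uIcc_of_le hr.1] at hs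
    simp only [radialAvg]
    congr 1
    refine intervalIntegral.integral_congr fun τ hτ => ?_
    rw [uIcc_of_le zero_le_one] at hτ
    rw [ih]
    refine ⟨le_max_right _ _, max_le ?_ (by positivity)⟩
    have h1 : τ * s ≤ 1 * s := mul_le_mul_of_nonneg_right hτ.2 hs.1
    have h2 := hs.2.trans hr.2
    push_cast at h2
    linarith

/-- Solvability of the boundary value problem with delay. -/
theorem exists_delayed_solution {n : ℕ} (hn : n ≠ 0) {w : ℝ → ℝ} {M : ℝ} (hw : Continuous w)
    (hw0 : ∀ x, 0 ≤ w x) (hwM : ∀ x, w x ≤ M) (hw1 : ∀ x, 1 ≤ x → w x = 0) {δ : ℝ} (hδ : 0 < δ) :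
    ∃ p : ℝ → ℝ, Continuous p ∧ p 1 = 1 ∧
      (∀ r ∈ Icc (0 : ℝ) 1, p r = p 0 - ∫ s in (0 : ℝ)..r, s * radialAvg n
        (fun t => source w t (p (max (t - δ) 0))) s) ∧
      ∀ r r', 0 ≤ r → r ≤ r' → r' ≤ 1 → p r - p r' ∈ Icc 0 (M * (r' - r)) := by
  -- After `k ≥ 1/δ` iterations the iterate solves the delayed equation on all of `[0,1]`, and it is
  -- jointly continuous in `(a, r)`.
  obtain ⟨k, hk⟩ := exists_nat_ge (1 / δ)
  have hkδ : 1 ≤ k * δ := by rwa [div_le_iff₀ hδ] at hk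
  have hcont := continuous_delayIter (n := n) hw δ k
  have heq : ∀ a, ∀ r ∈ Icc (0 : ℝ) 1, delayIter n w δ k a r = a - ∫ s in (0 : ℝ)..r,
      s * radialAvg n (fun t => source w t (delayIter n w δ k a (max (t - δ) 0))) s :=
    fun a r hr => (delayIter_succ_eq hδ a k r ⟨hr.1, hr.2.trans hkδ⟩).symm
  have hsc : ∀ a, Continuous fun t => source w t (delayIter n w δ k a (max (t - δ) 0)) := by
    intro a
    have h0 : Continuous fun t => delayIter n w δ k a (max (t - δ) 0) :=
      hcont.comp (f := fun t : ℝ => (a, max (t - δ) 0)) (by fun_prop)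
    exact (continuous_source hw).comp (continuous_id.prodMk h0)
  have hdiff : ∀ a r r', 0 ≤ r → r ≤ r' → r' ≤ 1 →
      delayIter n w δ k a r - delayIter n w δ k a r' ∈ Icc 0 (M * (r' - r)) := by
    intro a r r' h0 h1 h2
    have := sub_mem_of_primitive hn (hsc a) (M := M) (fun t _ => source_nonneg hw0 _ _)
      (fun t _ => mul_source_le hw0 hwM hw1 t _) h0 h1
    rw [heq a r ⟨h0, h1.trans h2⟩, heq a r' ⟨h0.trans h1, h2⟩]
    convert this using 1
    ring
  have hzero : ∀ a, delayIter n w δ k a 0 = a := fun a => by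
    rw [heq a 0 ⟨le_rfl, zero_le_one⟩]; simp
  have hM : 0 ≤ M := (hw0 0).trans (hwM 0)
  have hend : ∀ a, delayIter n w δ k a 1 ∈ Icc (a - M) a := by
    intro a
    have := hdiff a 0 1 le_rfl zero_le_one le_rfl
    rw [hzero] at this
    constructor <;> linarith [this.1, this.2]
  -- Shooting: a solution starting at `a` drops by at most `M` on `[0,1]`, so `a = 1` ends at or
  -- below 1 and `a = 1 + M` at or above 1.
  obtain ⟨a, -, ha⟩ : (1 : ℝ) ∈ (fun a => delayIter n w δ k a 1) '' Icc 1 (1 + M) := by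
    refine intermediate_value_Icc (by linarith) ?_ ⟨(hend 1).2, ?_⟩
    · exact (hcont.comp (f := fun a : ℝ => (a, (1 : ℝ))) (by fun_prop)).continuousOn
    · have := (hend (1 + M)).1; linarith
  refine ⟨delayIter n w δ k a, hcont.comp (f := fun r : ℝ => (a, r)) (by fun_prop), ha, ?_,
    hdiff a⟩
  intro r hr
  rw [hzero]
  exact heq a r hr

/-- The delayed solutions take values in `[1, 1 + M]` and are `M`-Lipschitz uniformly in the delay.
By Arzelà–Ascoli a subsequence converges, and dominated convergence passes to the limit in the
integral equation. -/
theorem exists_profile_integral_equation {n : ℕ} (hn : n ≠ 0) {w : ℝ → ℝ} {M : ℝ}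
    (hw : Continuous w) (hw0 : ∀ x, 0 ≤ w x) (hwM : ∀ x, w x ≤ M)
    (hw1 : ∀ x, 1 ≤ x → w x = 0) :
    ∃ q : ℝ → ℝ, Continuous q ∧ (∀ r, 1 ≤ q r) ∧ q 1 = 1 ∧
      ∀ r ∈ Icc (0 : ℝ) 1, q r = q 0 - ∫ s in (0 : ℝ)..r,
        s * radialAvg n (fun t => q t * w (t * q t)) s := by
  have hM : 0 ≤ M := (hw0 0).trans (hwM 0)
  set δ : ℕ → ℝ := fun j => 1 / ((j : ℝ) + 1) with hδdef
  have hδ : ∀ j, 0 < δ j := fun j => by positivity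
  have hδ0 : Tendsto δ atTop (𝓝 0) := tendsto_one_div_add_atTop_nhds_zero_nat
  choose p hpc hp1 hpe hpl using fun j => exists_delayed_solution hn hw hw0 hwM hw1 (hδ j)
  have hpb : ∀ j, ∀ r ∈ Icc (0 : ℝ) 1, p j r ∈ Icc 1 (1 + M) := by
    intro j r hr
    have h := hpl j r 1 hr.1 hr.2 le_rfl
    rw [hp1] at h
    have : M * (1 - r) ≤ M * 1 := mul_le_mul_of_nonneg_left (by linarith [hr.1]) hM
    constructor <;> linarith [h.1, h.2]
  have hpL : ∀ j, ∀ r ∈ Icc (0 : ℝ) 1, ∀ r' ∈ Icc (0 : ℝ) 1, |p j r - p j r'| ≤ M * |r - r'| := by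
    intro j r hr r' hr'
    rcases le_total r r' with h | h
    · have := hpl j r r' hr.1 h hr'.2
      rw [abs_of_nonneg this.1, abs_sub_comm, abs_of_nonneg (by linarith)]
      exact this.2
    · have := hpl j r' r hr'.1 h hr.2
      rw [abs_sub_comm, abs_of_nonneg this.1, abs_of_nonneg (by linarith)]
      exact this.2
  let F : ℕ → BoundedContinuousFunction (Icc (0 : ℝ) 1) ℝ := fun j =>
    BoundedContinuousFunction.mkOfCompact ⟨fun x => p j x, (hpc j).comp continuous_subtype_val⟩
  have hcomp : IsCompact {G : BoundedContinuousFunction (Icc (0 : ℝ) 1) ℝ |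
      (∀ x, G x ∈ Icc 1 (1 + M)) ∧ ∀ x y, dist (G x) (G y) ≤ M * dist x y} := by
    refine BoundedContinuousFunction.arzela_ascoli₂ (Icc 1 (1 + M)) isCompact_Icc _ ?_
      (fun G x hG => hG.1 x) ?_
    · have hev : ∀ x, Continuous fun G : BoundedContinuousFunction (Icc (0 : ℝ) 1) ℝ => G x :=
        fun x => continuous_eval_const x
      simp only [ofPred_and, ofPred_forall]
      refine (isClosed_iInter fun x => isClosed_Icc.preimage (hev x)).inter
        (isClosed_iInter fun x => isClosed_iInter fun y => ?_)
      exact isClosed_le ((hev x).dist (hev y)) continuous_const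
    · refine Metric.equicontinuous_of_continuity_modulus (fun t => M * t) ?_ _ ?_
      · have : Continuous fun t : ℝ => M * t := by fun_prop
        simpa using this.tendsto 0
      · rintro x y ⟨G, hG⟩
        exact hG.2 x y
  obtain ⟨G, hG, φ, hφ, hlim⟩ := hcomp.tendsto_subseq (x := F)
    (fun j => ⟨fun x => hpb j x x.2, fun x y => hpL j x x.2 y y.2⟩)
  set q : ℝ → ℝ := fun r => G (projIcc 0 1 zero_le_one r) with hq
  have hqc : Continuous q := G.continuous.comp continuous_projIcc
  have hptw : ∀ r ∈ Icc (0 : ℝ) 1, Tendsto (fun j => p (φ j) r) atTop (𝓝 (q r)) := by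
    intro r hr
    have := ((continuous_eval_const
      (F := BoundedContinuousFunction (Icc (0 : ℝ) 1) ℝ) ⟨r, hr⟩).tendsto G).comp hlim
    simp only [hq, projIcc_of_mem zero_le_one hr]
    exact this
  have hδφ : Tendsto (fun j => δ (φ j)) atTop (𝓝 0) := hδ0.comp hφ.tendsto_atTop
  have hmem : ∀ j, ∀ r ∈ Icc (0 : ℝ) 1, max (r - δ j) 0 ∈ Icc (0 : ℝ) 1 := fun j r hr =>
    ⟨le_max_right _ _, max_le (by linarith [hr.2, hδ j]) zero_le_one⟩
  -- The delay moves the argument by at most `δ`, hence the value by at most `M δ`.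
  have hptw' : ∀ r ∈ Icc (0 : ℝ) 1,
      Tendsto (fun j => p (φ j) (max (r - δ (φ j)) 0)) atTop (𝓝 (q r)) := by
    intro r hr
    refine (hptw r hr).congr_dist ?_
    refine squeeze_zero (fun _ => dist_nonneg) (g := fun j => M * δ (φ j)) (fun j => ?_)
      (by simpa using hδφ.const_mul M)
    refine (hpL (φ j) r hr _ (hmem _ r hr)).trans (mul_le_mul_of_nonneg_left ?_ hM)
    have := hδ (φ j)
    rcases max_cases (r - δ (φ j)) 0 with h | h <;> rw [h.1, abs_le] <;>
      constructor <;> linarith [hr.1]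
  have hG1 : ∀ r, q r ∈ Icc 1 (1 + M) := fun r => hG.1 _
  have hsrc : ∀ t, source w t (q t) = q t * w (t * q t) := fun t => by
    rw [source, max_eq_left (zero_le_one.trans (hG1 t).1)]
  have hsc : Continuous (fun z : ℝ × ℝ => source w z.1 z.2) := continuous_source hw
  have havg : ∀ s ∈ Icc (0 : ℝ) 1, Tendsto (fun j => radialAvg n (fun t => source w t
      (p (φ j) (max (t - δ (φ j)) 0))) s) atTop
      (𝓝 (radialAvg n (fun t => q t * w (t * q t)) s)) := by
    intro s hs
    simp only [radialAvg, ← hsrc]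
    refine intervalIntegral.tendsto_integral_filter_of_dominated_convergence
      (fun _ => (1 + M) * M) ?_ ?_ (by simp) ?_
    · refine Eventually.of_forall fun j => Continuous.aestronglyMeasurable ?_
      have := hpc (φ j)
      have h0 : Continuous fun τ : ℝ =>
        source w (τ * s) (p (φ j) (max (τ * s - δ (φ j)) 0)) :=
        hsc.comp (f := fun τ : ℝ => (τ * s, p (φ j) (max (τ * s - δ (φ j)) 0))) (by fun_prop)
      fun_prop
    · refine Eventually.of_forall fun j => Eventually.of_forall fun τ hτ => ?_
      rw [uIoc_of_le zero_le_one] at hτ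
      have hts : τ * s ∈ Icc (0 : ℝ) 1 :=
        ⟨mul_nonneg hτ.1.le hs.1, mul_le_one₀ hτ.2 hs.1 hs.2⟩
      have hb := hpb (φ j) _ (hmem (φ j) _ hts)
      rw [Real.norm_of_nonneg (mul_nonneg (pow_nonneg hτ.1.le _) (source_nonneg hw0 _ _))]
      calc _ ≤ 1 * source w (τ * s) (p (φ j) (max (τ * s - δ (φ j)) 0)) :=
            mul_le_mul_of_nonneg_right (pow_le_one₀ hτ.1.le hτ.2) (source_nonneg hw0 _ _)
        _ ≤ (1 + M) * M := by
          rw [one_mul, source, max_eq_left (zero_le_one.trans hb.1)]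
          exact mul_le_mul hb.2 (hwM _) (hw0 _) (by linarith)
    · refine Eventually.of_forall fun τ hτ => ?_
      rw [uIoc_of_le zero_le_one] at hτ
      have hts : τ * s ∈ Icc (0 : ℝ) 1 :=
        ⟨mul_nonneg hτ.1.le hs.1, mul_le_one₀ hτ.2 hs.1 hs.2⟩
      refine Tendsto.const_mul _ ?_
      exact (hsc.tendsto (τ * s, q (τ * s))).comp (tendsto_const_nhds.prodMk_nhds (hptw' _ hts))
  refine ⟨q, hqc, fun r => (hG1 r).1, ?_, ?_⟩
  · refine tendsto_nhds_unique (hptw 1 ⟨zero_le_one, le_rfl⟩) ?_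
    simp [hp1]
  · intro r hr
    refine tendsto_nhds_unique (hptw r hr) ?_
    have hint : Tendsto (fun j => ∫ s in (0 : ℝ)..r, s * radialAvg n (fun t => source w t
        (p (φ j) (max (t - δ (φ j)) 0))) s) atTop
        (𝓝 (∫ s in (0 : ℝ)..r, s * radialAvg n (fun t => q t * w (t * q t)) s)) := by
      have hkc : ∀ j, Continuous fun t => source w t (p (φ j) (max (t - δ (φ j)) 0)) := by
        intro j
        have := hpc (φ j)
        exact hsc.comp (f := fun t : ℝ => (t, p (φ j) (max (t - δ (φ j)) 0))) (by fun_prop)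
      refine intervalIntegral.tendsto_integral_filter_of_dominated_convergence
        (fun _ => M) ?_ ?_ (by simp) ?_
      · refine Eventually.of_forall fun j => Continuous.aestronglyMeasurable ?_
        exact continuous_mul_radialAvg (hkc j)
      · refine Eventually.of_forall fun j => Eventually.of_forall fun s hs => ?_
        rw [uIoc_of_le hr.1] at hs
        have := mul_radialAvg_mem hn (hkc j) (M := M) (fun t _ => source_nonneg hw0 _ _)
          (fun t _ => mul_source_le hw0 hwM hw1 t _) hs.1.le
        rw [Real.norm_of_nonneg this.1]
        exact this.2
      · refine Eventually.of_forall fun s hs => ?_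
        rw [uIoc_of_le hr.1] at hs
        exact (havg s ⟨hs.1.le, hs.2.trans hr.2⟩).const_mul s
    have h0 := (hptw 0 ⟨le_rfl, zero_le_one⟩).sub hint
    exact h0.congr fun j => (hpe (φ j) r hr).symm

/-! ### Qualitative properties of solutions of the radial equation -/

/-- A positive second derivative would make the point a local minimum too, so `f` would be locally
constant with second derivative 0. -/
theorem deriv_deriv_nonpos_of_isLocalMax {f : ℝ → ℝ} {x : ℝ} (h : IsLocalMax f x)
    (hc : ContinuousAt f x) : deriv (deriv f) x ≤ 0 := by
  by_contra! hpos
  have hmin := isLocalMin_of_deriv_deriv_pos hpos h.deriv_eq_zero hc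
  have hconst : f =ᶠ[𝓝 x] fun _ => f x := by
    filter_upwards [h, hmin] with y h1 h2 using le_antisymm h1 h2
  have h2 : deriv (deriv f) x = 0 := by
    rw [hconst.deriv.deriv_eq]; simp
  exact hpos.ne' h2

theorem deriv_deriv_nonneg_of_isLocalMin {f : ℝ → ℝ} {x : ℝ} (h : IsLocalMin f x)
    (hc : ContinuousAt f x) : 0 ≤ deriv (deriv f) x := by
  have := deriv_deriv_nonpos_of_isLocalMax (f := fun y => -f y) h.neg hc.neg
  have e : deriv (fun y => -f y) = fun y => -deriv f y := by ext; simp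
  rw [e] at this
  simpa using this

/-- `f` solves `-f'' - (N-1)/r f' + (N-1)/r² f = V f` on `(0,1)` and is continuous on `[0,1]`. -/
structure SolvesRadial (N : ℕ) (V f : ℝ → ℝ) : Prop where
  continuousOn : ContinuousOn f (Icc 0 1)
  differentiableAt : ∀ r ∈ Ioo (0 : ℝ) 1, DifferentiableAt ℝ f r
  differentiableAt_deriv : ∀ r ∈ Ioo (0 : ℝ) 1, DifferentiableAt ℝ (deriv f) r
  ode : ∀ r ∈ Ioo (0 : ℝ) 1,
    -deriv (deriv f) r - ((N : ℝ) - 1) / r * deriv f r + ((N : ℝ) - 1) / r ^ 2 * f r = V r * f r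

/-- At an interior maximum with value at least 1, the terms `-f''` and `(N-1) f/r²` have a positive
sum, while `V f ≤ 0`. -/
theorem SolvesRadial.lt_one {N : ℕ} {V f : ℝ → ℝ} (h : SolvesRadial N V f) (hN : 1 < N)
    (h0 : f 0 = 0) (h1 : f 1 = 1) (hV : ∀ r ∈ Ioo (0 : ℝ) 1, 1 ≤ f r → V r ≤ 0) :
    ∀ r ∈ Ioo (0 : ℝ) 1, f r < 1 := by
  intro r hr
  by_contra! hge
  obtain ⟨m, hm, hmax⟩ := isCompact_Icc.exists_isMaxOn (nonempty_Icc.2 zero_le_one) h.continuousOn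
  obtain ⟨x, hx, hxmax, hx1⟩ : ∃ x ∈ Ioo (0 : ℝ) 1, (∀ y ∈ Icc (0 : ℝ) 1, f y ≤ f x) ∧ 1 ≤ f x := by
    have hrm := hmax (Ioo_subset_Icc_self hr)
    simp only [mem_ofPred_eq] at hrm
    rcases eq_or_ne m 0 with rfl | hm0
    · rw [h0] at hrm; linarith
    rcases eq_or_ne m 1 with rfl | hm1
    -- If the maximum is attained at the endpoint 1, its value is `1 ≤ f r`, so `r` is an interior
    -- maximizer as well.
    · refine ⟨r, hr, fun y hy => ?_, hge⟩
      have := hmax hy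
      simp only [mem_ofPred_eq] at this
      linarith
    · exact ⟨m, ⟨lt_of_le_of_ne hm.1 hm0.symm, lt_of_le_of_ne hm.2 hm1⟩, fun y hy => hmax hy,
        hge.trans hrm⟩
  have hloc : IsLocalMax f x := by
    filter_upwards [Icc_mem_nhds hx.1 hx.2] with y hy using hxmax y hy
  have h2 := deriv_deriv_nonpos_of_isLocalMax hloc (h.differentiableAt x hx).continuousAt
  have h3 := h.ode x hx
  rw [hloc.deriv_eq_zero] at h3
  have h4 : V x * f x ≤ 0 := mul_nonpos_of_nonpos_of_nonneg (hV x hx hx1) (by linarith)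
  have hN' : (0 : ℝ) < (N : ℝ) - 1 := by
    have : (1 : ℝ) < N := by exact_mod_cast hN
    linarith
  have h5 : 0 < ((N : ℝ) - 1) / x ^ 2 * f x :=
    mul_pos (div_pos hN' (pow_pos hx.1 2)) (by linarith)
  linarith

/-- A failure of strict growth produces an interior local maximum `x` and a later interior local
minimum `z` with `f z ≤ f x`. The equation gives `V x ≥ (N-1)/x² > (N-1)/z² ≥ V z`, whereas `V`
decreases as `f` grows, so `V x ≤ V z`. -/
theorem SolvesRadial.strictMonoOn {N : ℕ} {V f : ℝ → ℝ} (h : SolvesRadial N V f) (hN : 1 < N)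
    (h0 : f 0 = 0) (h1 : f 1 = 1) (hpos : ∀ r ∈ Ioo (0 : ℝ) 1, 0 < f r)
    (hlt : ∀ r ∈ Ioo (0 : ℝ) 1, f r < 1)
    (hV : ∀ r ∈ Ioo (0 : ℝ) 1, ∀ s ∈ Ioo (0 : ℝ) 1, f r ≤ f s → V s ≤ V r) :
    StrictMonoOn f (Icc 0 1) := by
  intro a ha b hb hab
  by_contra! hge
  have hN' : (0 : ℝ) < (N : ℝ) - 1 := by
    have : (1 : ℝ) < N := by exact_mod_cast hN
    linarith
  have hb1 : b < 1 := by
    refine lt_of_le_of_ne hb.2 ?_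
    rintro rfl
    rcases eq_or_ne a 0 with rfl | ha0
    · linarith
    · have := hlt a ⟨lt_of_le_of_ne ha.1 ha0.symm, hab⟩; linarith
  have hb0 : 0 < b := ha.1.trans_lt hab
  have hfb := hpos b ⟨hb0, hb1⟩
  have ha0 : 0 < a := by
    refine lt_of_le_of_ne ha.1 ?_
    rintro rfl
    linarith
  obtain ⟨m, hm, hmax⟩ := isCompact_Icc.exists_isMaxOn (nonempty_Icc.2 hb0.le)
    (h.continuousOn.mono (Icc_subset_Icc_right hb1.le))
  obtain ⟨x, hx, hxmax⟩ : ∃ x ∈ Ioo 0 b, ∀ y ∈ Icc 0 b, f y ≤ f x := by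
    rcases eq_or_ne m 0 with rfl | hm0
    · have := hmax (show b ∈ Icc 0 b from ⟨hb0.le, le_rfl⟩)
      simp only [mem_ofPred_eq] at this
      linarith
    rcases eq_or_ne m b with rfl | hmb
    · refine ⟨a, ⟨ha0, hab⟩, fun y hy => ?_⟩
      have := hmax hy
      simp only [mem_ofPred_eq] at this
      linarith
    · exact ⟨m, ⟨lt_of_le_of_ne hm.1 hm0.symm, lt_of_le_of_ne hm.2 hmb⟩, fun y hy => hmax hy⟩
  have hfbx : f b ≤ f x := hxmax b ⟨hb0.le, le_rfl⟩
  have hx1 : x < 1 := hx.2.trans hb1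
  obtain ⟨m', hm', hmin⟩ := isCompact_Icc.exists_isMinOn (nonempty_Icc.2 hx1.le)
    (h.continuousOn.mono (Icc_subset_Icc_left hx.1.le))
  obtain ⟨z, hz, hzmin, hzx⟩ : ∃ z ∈ Ioo x 1, (∀ y ∈ Icc x 1, f z ≤ f y) ∧ f z ≤ f x := by
    have hmb := hmin (show b ∈ Icc x 1 from ⟨hx.2.le, hb1.le⟩)
    simp only [mem_ofPred_eq] at hmb
    rcases eq_or_ne m' x with rfl | hmx
    · refine ⟨b, ⟨hx.2, hb1⟩, fun y hy => ?_, hfbx⟩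
      have := hmin hy
      simp only [mem_ofPred_eq] at this
      linarith
    rcases eq_or_ne m' 1 with rfl | hm1
    · have := hlt b ⟨hb0, hb1⟩; linarith
    · exact ⟨m', ⟨lt_of_le_of_ne hm'.1 hmx.symm, lt_of_le_of_ne hm'.2 hm1⟩,
        fun y hy => hmin hy, hmb.trans hfbx⟩
  have hxI : x ∈ Ioo (0 : ℝ) 1 := ⟨hx.1, hx1⟩
  have hzI : z ∈ Ioo (0 : ℝ) 1 := ⟨hx.1.trans hz.1, hz.2⟩
  have hxloc : IsLocalMax f x := by
    filter_upwards [Icc_mem_nhds hx.1 hx.2] with y hy using hxmax y hy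
  have hzloc : IsLocalMin f z := by
    filter_upwards [Icc_mem_nhds hz.1 hz.2] with y hy using hzmin y hy
  have hx2 := deriv_deriv_nonpos_of_isLocalMax hxloc (h.differentiableAt x hxI).continuousAt
  have hz2 := deriv_deriv_nonneg_of_isLocalMin hzloc (h.differentiableAt z hzI).continuousAt
  have ex := h.ode x hxI
  have ez := h.ode z hzI
  rw [hxloc.deriv_eq_zero] at ex
  rw [hzloc.deriv_eq_zero] at ez
  have h3 : ((N : ℝ) - 1) / x ^ 2 ≤ V x :=
    le_of_mul_le_mul_right (by linarith) (hpos x hxI)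
  have h4 : V z ≤ ((N : ℝ) - 1) / z ^ 2 :=
    le_of_mul_le_mul_right (by linarith) (hpos z hzI)
  have h5 : ((N : ℝ) - 1) / z ^ 2 < ((N : ℝ) - 1) / x ^ 2 := by
    apply div_lt_div_of_pos_left hN' (pow_pos hx.1 2)
    exact pow_lt_pow_left₀ hz.1 hx.1.le two_ne_zero
  linarith [hV z hzI x hxI hzx]

theorem SolvesRadial.hasDerivAt_flux {N m : ℕ} (hN : N = m + 3) {V f : ℝ → ℝ}
    (h : SolvesRadial N V f) {r : ℝ} (hr : r ∈ Ioo (0 : ℝ) 1) :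
    HasDerivAt (fun r => r ^ (m + 2) * deriv f r)
      ((m + 2) * r ^ m * f r - r ^ (m + 2) * (V r * f r)) r := by
  have h1 := (hasDerivAt_pow (m + 2) r).mul (h.differentiableAt_deriv r hr).hasDerivAt
  refine h1.congr_deriv ?_
  have hr0 : r ≠ 0 := hr.1.ne'
  rw [← h.ode r hr, hN]
  push_cast
  field_simp
  ring

/-- No control of `f'` at 0 is assumed. The flux `r^(N-1) f'` is Lipschitz, because its derivative
is bounded when `N ≥ 3`, and it is small at some point of each interval `(r, 2r)`. -/
theorem SolvesRadial.tendsto_flux {N m : ℕ} (hN : N = m + 3) {V f : ℝ → ℝ}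
    (h : SolvesRadial N V f) {C : ℝ} (hV : ∀ r ∈ Ioo (0 : ℝ) 1, |V r| ≤ C) :
    Tendsto (fun r => r ^ (m + 2) * deriv f r) (𝓝[>] 0) (𝓝 0) := by
  obtain ⟨K, hK⟩ := isCompact_Icc.exists_bound_of_continuousOn h.continuousOn
  set P : ℝ → ℝ := fun r => r ^ (m + 2) * deriv f r with hP
  have hK0 : 0 ≤ K := (norm_nonneg _).trans (hK 0 ⟨le_rfl, zero_le_one⟩)
  have hLip : ∀ r ∈ Ioo (0 : ℝ) 1, ∀ s ∈ Ioo (0 : ℝ) 1,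
      ‖P s - P r‖ ≤ ((m + 2) * K + C * K) * ‖s - r‖ := by
    intro r hr s hs
    refine Convex.norm_image_sub_le_of_norm_hasDerivWithin_le
      (fun x hx => (h.hasDerivAt_flux hN hx).hasDerivWithinAt) (fun x hx => ?_)
      (convex_Ioo 0 1) hr hs
    have hf := hK x (Ioo_subset_Icc_self hx)
    have hxm : x ^ m ≤ 1 := pow_le_one₀ hx.1.le hx.2.le
    have hxm' : x ^ (m + 2) ≤ 1 := pow_le_one₀ hx.1.le hx.2.le
    have hx0 := hx.1.le
    refine (norm_sub_le _ _).trans (add_le_add ?_ ?_)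
    · rw [norm_mul, Real.norm_of_nonneg (by positivity)]
      calc (m + 2) * x ^ m * ‖f x‖ ≤ (m + 2) * 1 * K := by gcongr
        _ = _ := by ring
    · rw [norm_mul, norm_mul, Real.norm_of_nonneg (by positivity)]
      calc x ^ (m + 2) * (‖V x‖ * ‖f x‖) ≤ 1 * (C * K) := by
            gcongr
            · exact (abs_nonneg _).trans (hV x hx)
            · exact hV x hx
        _ = _ := by ring
  have hbound : ∀ r ∈ Ioo (0 : ℝ) (1 / 2),
      ‖P r‖ ≤ 2 * |f (2 * r) - f r| + ((m + 2) * K + C * K) * r := by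
    intro r hr
    have hr2 : 2 * r < 1 := by linarith [hr.2]
    -- Mean value theorem on `[r, 2r]`: `|ξ f'(ξ)| ≤ 2 |f(2r) - f(r)|`, which tends to 0 by
    -- continuity of `f` at 0.
    obtain ⟨ξ, hξ, hξe⟩ := exists_deriv_eq_slope f (by linarith [hr.1] : r < 2 * r)
      (h.continuousOn.mono (Icc_subset_Icc hr.1.le hr2.le))
      (fun x hx => (h.differentiableAt x
        ⟨hr.1.trans hx.1, hx.2.trans hr2⟩).differentiableWithinAt)
    have hξI : ξ ∈ Ioo (0 : ℝ) 1 := ⟨hr.1.trans hξ.1, hξ.2.trans hr2⟩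
    have h1 : ‖P ξ‖ ≤ 2 * |f (2 * r) - f r| := by
      have e : f (2 * r) - f r = r * deriv f ξ := by
        rw [hξe]
        have := hr.1.ne'
        have h2 : 2 * r - r ≠ 0 := by linarith [hr.1]
        field_simp
        ring
      rw [e, abs_mul, abs_of_pos hr.1, hP, norm_mul, Real.norm_of_nonneg (pow_nonneg hξI.1.le _),
        ← mul_assoc]
      refine mul_le_mul_of_nonneg_right ?_ (norm_nonneg _)
      calc ξ ^ (m + 2) ≤ ξ ^ 1 := pow_le_pow_of_le_one hξI.1.le hξI.2.le (by omega)
        _ ≤ 2 * r := by simpa using hξ.2.le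
    have h2 := hLip ξ hξI r ⟨hr.1, by linarith [hr.2]⟩
    have h3 : ‖r - ξ‖ ≤ r := by
      rw [Real.norm_eq_abs, abs_le]; constructor <;> linarith [hξ.1, hξ.2]
    have hC : 0 ≤ C := (abs_nonneg _).trans (hV ξ hξI)
    have h4 : ((m + 2) * K + C * K) * ‖r - ξ‖ ≤ ((m + 2) * K + C * K) * r := by gcongr
    calc ‖P r‖ = ‖P ξ + (P r - P ξ)‖ := by congr 1; ring
      _ ≤ ‖P ξ‖ + ‖P r - P ξ‖ := norm_add_le _ _
      _ ≤ _ := add_le_add h1 (h2.trans h4)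
  refine squeeze_zero_norm' (a := fun r => 2 * |f (2 * r) - f r| + ((m + 2) * K + C * K) * r) ?_ ?_
  · filter_upwards [Ioo_mem_nhdsGT (show (0 : ℝ) < 1 / 2 by norm_num)] with r hr using hbound r hr
  · have hf0 : ContinuousWithinAt f (Icc 0 1) 0 := h.continuousOn 0 ⟨le_rfl, zero_le_one⟩
    have t1 : Tendsto (fun r : ℝ => f r) (𝓝[>] 0) (𝓝 (f 0)) :=
      hf0.tendsto.mono_left (nhdsWithin_le_iff.2 (by
        filter_upwards [Ioo_mem_nhdsGT (zero_lt_one' ℝ)] with r hr using Ioo_subset_Icc_self hr))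
    have t2 : Tendsto (fun r : ℝ => f (2 * r)) (𝓝[>] 0) (𝓝 (f 0)) := by
      refine t1.comp (tendsto_nhdsWithin_iff.2 ⟨?_, ?_⟩)
      · have : Continuous fun r : ℝ => 2 * r := by fun_prop
        simpa using (this.tendsto 0).mono_left nhdsWithin_le_nhds
      · filter_upwards [self_mem_nhdsWithin] with r hr
        exact mul_pos two_pos (mem_Ioi.1 hr)
    have t3 : Tendsto (fun r : ℝ => r) (𝓝[>] 0) (𝓝 0) := nhdsWithin_le_nhds
    simpa using (((t2.sub t1).abs).const_mul 2).add (t3.const_mul ((m + 2) * K + C * K))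

/-- A maximum principle for `(m y')' ≥ 0` on `{y > 0}` with vanishing flux at `0`. -/
theorem nonpos_of_flux {y P m : ℝ → ℝ} (hc : ContinuousOn y (Ioc 0 1))
    (hm : ∀ r ∈ Ioo (0 : ℝ) 1, 0 < m r)
    (hy : ∀ r ∈ Ioo (0 : ℝ) 1, HasDerivAt y (P r / m r) r)
    (hP : ∀ r ∈ Ioo (0 : ℝ) 1, DifferentiableAt ℝ P r)
    (hP' : ∀ r ∈ Ioo (0 : ℝ) 1, 0 < y r → 0 ≤ deriv P r)
    (h0 : Tendsto P (𝓝[>] 0) (𝓝 0)) (h1 : y 1 ≤ 0) : ∀ r ∈ Ioc (0 : ℝ) 1, y r ≤ 0 := by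
  intro r₀ hr₀
  by_contra! hpos
  have hr₀1 : r₀ < 1 := lt_of_le_of_ne hr₀.2 (by rintro rfl; linarith)
  have hclosed : ∀ {a b : ℝ}, 0 < a → b ≤ 1 → IsCompact (Icc a b ∩ y ⁻¹' Iic 0) := by
    intro a b ha hb
    exact isCompact_Icc.of_isClosed_subset ((hc.mono fun x hx =>
      ⟨ha.trans_le hx.1, hx.2.trans hb⟩).preimage_isClosed_of_isClosed isClosed_Icc isClosed_Iic)
      inter_subset_left
  -- `b` is the first point after `r₀` with `y ≤ 0`; between them `y` is positive and must somewhere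
  -- decrease, at `r₁`, where `P < 0`.
  obtain ⟨b, ⟨hbI, hby⟩, hbl⟩ := (hclosed hr₀.1 le_rfl).exists_isLeast ⟨1, ⟨hr₀.2, le_rfl⟩, h1⟩
  have hyb : y b ≤ 0 := hby
  have hrb : r₀ < b := lt_of_le_of_ne hbI.1 (by rintro rfl; linarith)
  obtain ⟨r₁, hr₁, hr₁e⟩ := exists_deriv_eq_slope y hrb
    (hc.mono fun x hx => ⟨hr₀.1.trans_le hx.1, hx.2.trans hbI.2⟩)
    (fun x hx => (hy x ⟨hr₀.1.trans hx.1, hx.2.trans_le hbI.2⟩).differentiableAt.differentiableWithinAt)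
  have hr₁I : r₁ ∈ Ioo (0 : ℝ) 1 := ⟨hr₀.1.trans hr₁.1, hr₁.2.trans_le hbI.2⟩
  have hyr₁ : 0 < y r₁ := by
    by_contra! hle
    exact absurd (hbl ⟨⟨hr₁.1.le, hr₁I.2.le⟩, hle⟩) (not_le.2 hr₁.2)
  have hPr₁ : P r₁ < 0 := by
    rw [(hy r₁ hr₁I).deriv] at hr₁e
    have : P r₁ / m r₁ < 0 := by
      rw [hr₁e]
      exact div_neg_of_neg_of_pos (by linarith) (by linarith)
    by_contra! hge
    exact absurd (div_nonneg hge (hm r₁ hr₁I).le) (not_le.2 this)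
  have hmono : ∀ a, 0 ≤ a → (∀ r ∈ Ioc a r₁, 0 < y r) → ∀ r ∈ Ioc a r₁, P r ≤ P r₁ := by
    intro a ha hya r hr
    have hsub : ∀ x ∈ Icc r r₁, x ∈ Ioo (0 : ℝ) 1 := fun x hx =>
      ⟨ha.trans_lt (hr.1.trans_le hx.1), hx.2.trans_lt hr₁I.2⟩
    refine monotoneOn_of_deriv_nonneg (convex_Icc r r₁)
      (fun x hx => (hP x (hsub x hx)).continuousAt.continuousWithinAt)
      (fun x hx => (hP x (hsub x (interior_subset hx))).differentiableWithinAt)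
      (fun x hx => ?_) ⟨le_rfl, hr.2⟩ ⟨hr.2, le_rfl⟩ hr.2
    have hx' := interior_subset hx
    exact hP' x (hsub x hx') (hya x ⟨hr.1.trans_le hx'.1, hx'.2⟩)
  -- To the left of `r₁`, as long as `y > 0`, `P` stays below `P r₁ < 0`. If this reaches 0, it
  -- contradicts `P → 0`. Otherwise `y` decreases from a point `a` with `y a ≤ 0` to `r₁`, where `y
  -- > 0`.
  by_cases hall : ∀ r ∈ Ioc 0 r₁, 0 < y r
  · have hle := hmono 0 le_rfl hall
    have : (0 : ℝ) ≤ P r₁ := by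
      refine le_of_tendsto h0 ?_
      filter_upwards [Ioo_mem_nhdsGT hr₁I.1] with r hr using hle r ⟨hr.1, hr.2.le⟩
    linarith
  · push Not at hall
    obtain ⟨c, hcI, hyc⟩ := hall
    obtain ⟨a, ⟨haI, hay⟩, hag⟩ := (hclosed hcI.1 hr₁I.2.le).exists_isGreatest
      ⟨c, ⟨le_rfl, hcI.2⟩, hyc⟩
    have hya : y a ≤ 0 := hay
    have ha0 : 0 < a := hcI.1.trans_le haI.1
    have har : a < r₁ := lt_of_le_of_ne haI.2 (by rintro rfl; linarith)
    have hyp : ∀ r ∈ Ioc a r₁, 0 < y r := by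
      intro r hr
      by_contra! hle
      exact absurd (hag ⟨⟨haI.1.trans hr.1.le, hr.2⟩, hle⟩) (not_le.2 hr.1)
    have hle := hmono a ha0.le hyp
    have hanti : y r₁ ≤ y a := by
      refine antitoneOn_of_deriv_nonpos (convex_Icc a r₁)
        (hc.mono fun x hx => ⟨ha0.trans_le hx.1, hx.2.trans hr₁I.2.le⟩)
        (fun x hx => ?_) (fun x hx => ?_) ⟨le_rfl, har.le⟩ ⟨har.le, le_rfl⟩ har.le
      · rw [interior_Icc] at hx
        exact (hy x ⟨ha0.trans hx.1, hx.2.trans hr₁I.2⟩).differentiableAt.differentiableWithinAt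
      · rw [interior_Icc] at hx
        have hxI : x ∈ Ioo (0 : ℝ) 1 := ⟨ha0.trans hx.1, hx.2.trans hr₁I.2⟩
        rw [(hy x hxI).deriv]
        exact div_nonpos_of_nonpos_of_nonneg
          ((hle x ⟨hx.1, hx.2.le⟩).trans hPr₁.le) (hm x hxI).le
    linarith

/-- The ratio satisfies `(g/f)' = Q/(r^(N-1) f²)` with the weighted Wronskian `Q = r^(N-1)(g'f -
f'g)`, and `Q' = r^(N-1) f g (U - V)`. Where `g > f` the sign hypotheses give `Q' ≥ 0`, where `g <
f` they give `Q' ≤ 0`. So `nonpos_of_flux` applies to both `g/f - 1` and `1 - g/f`. -/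
theorem SolvesRadial.eqOn {N : ℕ} (hN : 3 ≤ N) {U V f g : ℝ → ℝ}
    (hf : SolvesRadial N U f) (hg : SolvesRadial N V g) (hfpos : ∀ r ∈ Ioc (0 : ℝ) 1, 0 < f r)
    (hg0 : ∀ r ∈ Ioo (0 : ℝ) 1, 0 ≤ g r) (h0 : g 0 = f 0) (h1 : g 1 = f 1) {C : ℝ}
    (hU : ∀ r ∈ Ioo (0 : ℝ) 1, |U r| ≤ C) (hV : ∀ r ∈ Ioo (0 : ℝ) 1, |V r| ≤ C)
    (hUV : ∀ r ∈ Ioo (0 : ℝ) 1, f r ≤ g r → V r ≤ U r)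
    (hVU : ∀ r ∈ Ioo (0 : ℝ) 1, g r ≤ f r → U r ≤ V r) : EqOn g f (Icc 0 1) := by
  obtain ⟨m, hm⟩ := Nat.exists_eq_add_of_le' hN
  set Q : ℝ → ℝ := fun r => r ^ (m + 2) * deriv g r * f r - r ^ (m + 2) * deriv f r * g r with hQ
  have hQd : ∀ r ∈ Ioo (0 : ℝ) 1,
      HasDerivAt Q (r ^ (m + 2) * (f r * g r) * (U r - V r)) r := by
    intro r hr
    have h2 := ((hg.hasDerivAt_flux hm hr).mul (hf.differentiableAt r hr).hasDerivAt).sub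
      ((hf.hasDerivAt_flux hm hr).mul (hg.differentiableAt r hr).hasDerivAt)
    refine h2.congr_deriv ?_
    ring
  have hlim : Tendsto Q (𝓝[>] 0) (𝓝 0) := by
    have hb : ∀ {k : ℝ → ℝ}, ContinuousOn k (Icc 0 1) → Tendsto k (𝓝[>] 0) (𝓝 (k 0)) := by
      intro k hk
      exact (hk 0 ⟨le_rfl, zero_le_one⟩).tendsto.mono_left (nhdsWithin_le_iff.2 (by
        filter_upwards [Ioo_mem_nhdsGT (zero_lt_one' ℝ)] with r hr using Ioo_subset_Icc_self hr))
    have := ((hg.tendsto_flux hm hV).mul (hb hf.continuousOn)).sub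
      ((hf.tendsto_flux hm hU).mul (hb hg.continuousOn))
    simpa using this
  have hratio : ∀ r ∈ Ioo (0 : ℝ) 1,
      HasDerivAt (fun r => g r / f r) (Q r / (r ^ (m + 2) * f r ^ 2)) r := by
    intro r hr
    have hfr := (hfpos r ⟨hr.1, hr.2.le⟩).ne'
    have h2 := (hg.differentiableAt r hr).hasDerivAt.div (hf.differentiableAt r hr).hasDerivAt hfr
    refine h2.congr_deriv ?_
    have := hr.1.ne'
    simp only [hQ]
    field_simp
  have hrc : ContinuousOn (fun r => g r / f r) (Ioc 0 1) :=
    (hg.continuousOn.mono Ioc_subset_Icc_self).div (hf.continuousOn.mono Ioc_subset_Icc_self)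
      fun r hr => (hfpos r hr).ne'
  have hmpos : ∀ r ∈ Ioo (0 : ℝ) 1, 0 < r ^ (m + 2) * f r ^ 2 := fun r hr =>
    mul_pos (pow_pos hr.1 _) (pow_pos (hfpos r ⟨hr.1, hr.2.le⟩) _)
  have hf1 := hfpos 1 ⟨zero_lt_one, le_rfl⟩
  have hfac : ∀ r ∈ Ioo (0 : ℝ) 1, 0 ≤ r ^ (m + 2) * (f r * g r) := fun r hr =>
    mul_nonneg (pow_nonneg hr.1.le _) (mul_nonneg (hfpos r ⟨hr.1, hr.2.le⟩).le (hg0 r hr))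
  have hup := nonpos_of_flux (y := fun r => g r / f r - 1) (P := Q)
    (m := fun r => r ^ (m + 2) * f r ^ 2) (hrc.sub continuousOn_const) hmpos
    (fun r hr => (hratio r hr).sub_const 1) (fun r hr => (hQd r hr).differentiableAt)
    (fun r hr hy => by
      rw [(hQd r hr).deriv]
      have hlt : 1 < g r / f r := by linarith
      rw [one_lt_div (hfpos r ⟨hr.1, hr.2.le⟩)] at hlt
      exact mul_nonneg (hfac r hr) (sub_nonneg.2 (hUV r hr hlt.le)))
    hlim (by simp [h1, div_self hf1.ne'])
  have hlow := nonpos_of_flux (y := fun r => 1 - g r / f r) (P := fun r => -Q r)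
    (m := fun r => r ^ (m + 2) * f r ^ 2) (continuousOn_const.sub hrc) hmpos
    (fun r hr => by rw [neg_div]; exact (hratio r hr).const_sub 1)
    (fun r hr => (hQd r hr).differentiableAt.neg)
    (fun r hr hy => by
      have e : deriv (fun r => -Q r) r = _ := (hQd r hr).neg.deriv
      rw [e]
      have hlt : g r / f r < 1 := by linarith
      rw [div_lt_one (hfpos r ⟨hr.1, hr.2.le⟩)] at hlt
      have := mul_nonneg (hfac r hr) (sub_nonneg.2 (hVU r hr hlt.le))
      linarith)
    (by simpa using hlim.neg) (by simp [h1, div_self hf1.ne'])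
  intro r hr
  rcases eq_or_lt_of_le hr.1 with rfl | hr0
  · exact h0
  · have e : g r / f r = 1 :=
      le_antisymm (by linarith [hup r ⟨hr0, hr.2⟩]) (by linarith [hlow r ⟨hr0, hr.2⟩])
    rwa [div_eq_one_iff_eq (hfpos r ⟨hr0, hr.2⟩).ne'] at e

/-! ### The potential -/

namespace IsPotential

theorem differentiableOn {W : ℝ → ℝ} (hW : IsPotential W) : DifferentiableOn ℝ W (Iic 1) :=
  hW.contDiffOn.differentiableOn one_ne_zero

theorem continuousOn_derivWithin {W : ℝ → ℝ} (hW : IsPotential W) :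
    ContinuousOn (derivWithin W (Iic 1)) (Iic 1) :=
  hW.contDiffOn.continuousOn_derivWithin (uniqueDiffOn_Iic 1) le_rfl

theorem monotoneOn_derivWithin {W : ℝ → ℝ} (hW : IsPotential W) :
    MonotoneOn (derivWithin W (Iic 1)) (Iic 1) :=
  hW.convexOn.monotoneOn_derivWithin hW.differentiableOn

theorem derivWithin_zero {W : ℝ → ℝ} (hW : IsPotential W) : derivWithin W (Iic 1) 0 = 0 := by
  have hn : Iic (1 : ℝ) ∈ 𝓝 0 := Iic_mem_nhds one_pos
  rw [derivWithin_of_mem_nhds hn]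
  refine IsLocalMin.deriv_eq_zero ?_
  filter_upwards [hn] with t ht
  rw [hW.zero]
  rcases eq_or_ne t 0 with rfl | h
  · exact hW.zero.ge
  · exact (hW.pos t ht h).le

theorem nonneg {W : ℝ → ℝ} (hW : IsPotential W) {t : ℝ} (ht : t ≤ 1) : 0 ≤ W t := by
  rcases eq_or_ne t 0 with rfl | h
  · exact hW.zero.ge
  · exact (hW.pos t ht h).le

theorem tangent_le {W : ℝ → ℝ} (hW : IsPotential W) {s t : ℝ} (hs : s ≤ 1) (ht : t ≤ 1) :
    W t + derivWithin W (Iic 1) t * (s - t) ≤ W s := by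
  rcases lt_trichotomy t s with h | rfl | h
  · have := hW.convexOn.derivWithin_le_slope ht hs h (hW.differentiableOn t ht)
    rw [slope_def_field, le_div_iff₀ (by linarith)] at this
    linarith
  · simp
  · have := hW.convexOn.slope_le_derivWithin hs ht h (hW.differentiableOn t ht)
    rw [slope_def_field, div_le_iff₀ (by linarith)] at this
    linarith

end IsPotential

/-- The coefficient `W'(1 - f²)/ε²` of the radial equation, with `f` truncated to `[0,1]`. -/
noncomputable def coefficient (W : ℝ → ℝ) (ε f : ℝ) : ℝ :=
  1 / ε ^ 2 * derivWithin W (Iic 1) (1 - max 0 (min 1 f) ^ 2)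

theorem truncate_mem (f : ℝ) : max 0 (min 1 f) ∈ Icc (0 : ℝ) 1 :=
  ⟨le_max_left _ _, max_le zero_le_one (min_le_left _ _)⟩

theorem coefficient_eq {W : ℝ → ℝ} (ε : ℝ) {f : ℝ} (hf : f ∈ Icc (0 : ℝ) 1) :
    coefficient W ε f = 1 / ε ^ 2 * derivWithin W (Iic 1) (1 - f ^ 2) := by
  rw [coefficient, min_eq_right hf.2, max_eq_right hf.1]

theorem continuous_coefficient {W : ℝ → ℝ} (hW : IsPotential W) (ε : ℝ) :
    Continuous (coefficient W ε) := by
  refine continuous_const.mul (hW.continuousOn_derivWithin.comp_continuous (by fun_prop) fun f => ?_)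
  exact mem_Iic.2 (sub_le_self _ (sq_nonneg _))

theorem antitone_coefficient {W : ℝ → ℝ} (hW : IsPotential W) (ε : ℝ) :
    Antitone (coefficient W ε) := by
  intro f g hfg
  refine mul_le_mul_of_nonneg_left (hW.monotoneOn_derivWithin ?_ ?_ ?_) (by positivity)
  · exact mem_Iic.2 (sub_le_self _ (sq_nonneg _))
  · exact mem_Iic.2 (sub_le_self _ (sq_nonneg _))
  · have h1 : max 0 (min 1 f) ≤ max 0 (min 1 g) := by gcongr
    have h2 := (truncate_mem f).1
    nlinarith

theorem coefficient_of_one_le {W : ℝ → ℝ} (hW : IsPotential W) (ε : ℝ) {f : ℝ} (hf : 1 ≤ f) :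
    coefficient W ε f = 0 := by
  rw [coefficient, min_eq_left hf]
  simp [hW.derivWithin_zero]

theorem coefficient_nonneg {W : ℝ → ℝ} (hW : IsPotential W) (ε : ℝ) (f : ℝ) :
    0 ≤ coefficient W ε f := by
  rw [← coefficient_of_one_le hW ε (le_max_left 1 f)]
  exact antitone_coefficient hW ε (le_max_right _ _)

theorem coefficient_le {W : ℝ → ℝ} (hW : IsPotential W) (ε : ℝ) (f : ℝ) :
    coefficient W ε f ≤ coefficient W ε 0 := by
  rcases le_total 0 f with h | h
  · exact antitone_coefficient hW ε h
  · rw [coefficient, coefficient, min_eq_right (h.trans zero_le_one), max_eq_left h]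
    simp

theorem abs_coefficient_le {W : ℝ → ℝ} (hW : IsPotential W) (ε : ℝ) (f : ℝ) :
    |coefficient W ε f| ≤ coefficient W ε 0 := by
  rw [abs_of_nonneg (coefficient_nonneg hW ε f)]
  exact coefficient_le hW ε f

/-- Proved with the untruncated coefficient, since it is what allows the truncated one to replace
it. For `f ≥ 1`, monotonicity of `W'` gives `W'(1 - f²) ≤ W'(0) = 0`. -/
theorem IsRadialProfile.lt_one {N : ℕ} (hN : 1 < N) {W : ℝ → ℝ} (hW : IsPotential W) {ε : ℝ}
    {f : ℝ → ℝ} (hf : IsRadialProfile N W ε f) : ∀ r ∈ Ioo (0 : ℝ) 1, f r < 1 := by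
  have h : SolvesRadial N (fun r => 1 / ε ^ 2 * derivWithin W (Iic 1) (1 - f r ^ 2)) f :=
    ⟨hf.continuousOn, hf.differentiableAt, hf.differentiableAt_deriv,
      fun r hr => by rw [hf.ode r hr]; ring⟩
  refine h.lt_one hN hf.left hf.right fun r hr hfr => ?_
  refine mul_nonpos_of_nonneg_of_nonpos (by positivity) ?_
  rw [← hW.derivWithin_zero]
  refine hW.monotoneOn_derivWithin (mem_Iic.2 (sub_le_self _ (sq_nonneg _)))
    (mem_Iic.2 zero_le_one) ?_
  nlinarith

theorem IsRadialProfile.solvesRadial {N : ℕ} (hN : 1 < N) {W : ℝ → ℝ} (hW : IsPotential W) {ε : ℝ}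
    {f : ℝ → ℝ} (hf : IsRadialProfile N W ε f) :
    SolvesRadial N (fun r => coefficient W ε (f r)) f := by
  refine ⟨hf.continuousOn, hf.differentiableAt, hf.differentiableAt_deriv, fun r hr => ?_⟩
  rw [hf.ode r hr, coefficient_eq ε
    ⟨hf.nonneg r (Ioo_subset_Icc_self hr), (hf.lt_one hN hW r hr).le⟩]
  ring

/-! ### Regular profiles -/

/-- The profile is `f(r) = r q(r)`; `A = q'/r`, and the radial equation with zeroth order
coefficient `V` becomes `r A' + (N+2) A = -q V`. -/
structure RegularProfile (N : ℕ) (V q A : ℝ → ℝ) : Prop where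
  continuous_V : Continuous V
  continuous_q : Continuous q
  continuous_A : Continuous A
  V_nonneg : ∀ r, 0 ≤ V r
  one_le : ∀ r, 1 ≤ q r
  A_nonpos : ∀ r, A r ≤ 0
  q_one : q 1 = 1
  A_zero : (N + 2) * A 0 = -(q 0 * V 0)
  hasDerivAt_q : ∀ r ∈ Ioo (0 : ℝ) 1, HasDerivAt q (r * A r) r
  hasDerivAt_A : ∀ r ∈ Ioo (0 : ℝ) 1, HasDerivAt A (-(q r * V r + (N + 2) * A r) / r) r
  deriv_nonneg : ∀ r ∈ Ioo (0 : ℝ) 1, 0 ≤ q r + r ^ 2 * A r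

theorem radialAvg_eq {n : ℕ} {k : ℝ → ℝ} {r : ℝ} (hr : r ≠ 0) :
    radialAvg n k r = (r ^ (n + 1))⁻¹ * ∫ t in (0 : ℝ)..r, t ^ n * k t := by
  have h := intervalIntegral.integral_comp_mul_right (a := 0) (b := 1)
    (fun t => t ^ n * k t) hr
  simp only [zero_mul, one_mul, smul_eq_mul] at h
  have h2 : ∫ x in (0 : ℝ)..1, (x * r) ^ n * k (x * r) = r ^ n * radialAvg n k r := by
    rw [radialAvg, ← intervalIntegral.integral_const_mul]
    congr 1
    ext x
    ring
  rw [h2] at h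
  rw [pow_succ, mul_inv, mul_assoc, ← h]
  field_simp

theorem hasDerivAt_radialAvg {n : ℕ} {k : ℝ → ℝ} (hk : Continuous k) {r : ℝ} (hr : r ≠ 0) :
    HasDerivAt (radialAvg n k) ((k r - (n + 1) * radialAvg n k r) / r) r := by
  have hc : Continuous fun t => t ^ n * k t := by fun_prop
  have h1 := (hasDerivAt_pow (n + 1) r).inv (pow_ne_zero _ hr)
  have h2 := intervalIntegral.integral_hasDerivAt_right (hc.intervalIntegrable 0 r)
    (hc.stronglyMeasurableAtFilter _ _) hc.continuousAt
  have h3 := h1.mul h2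
  have he : radialAvg n k =ᶠ[𝓝 r] fun r => (r ^ (n + 1))⁻¹ * ∫ t in (0 : ℝ)..r, t ^ n * k t := by
    filter_upwards [isOpen_ne.mem_nhds hr] with x hx using radialAvg_eq hx
  refine (h3.congr_of_eventuallyEq he).congr_deriv ?_
  rw [radialAvg_eq hr]
  simp only [Pi.inv_apply]
  push_cast
  field_simp
  ring

theorem radialAvg_zero {n : ℕ} {k : ℝ → ℝ} : (n + 1) * radialAvg n k 0 = k 0 := by
  simp only [radialAvg, mul_zero, intervalIntegral.integral_mul_const, integral_pow]
  have : (n : ℝ) + 1 ≠ 0 := by positivity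
  field_simp
  simp

/-- The equation for `f = r q` says that `q` is a radial solution of `-Δq = V q` in dimension `N +
2`, that is `(r^(N+2) A)' = -r^(N+1) q V`. Integrating from 0 gives `A = -radialAvg (N+1) (qV)`, and
integrating `q' = rA` gives the integral equation already solved. The truncation is harmless because
the solution turns out to satisfy `0 ≤ f ≤ 1`. -/
theorem exists_regularProfile {N : ℕ} (hN : 3 ≤ N) {W : ℝ → ℝ} (hW : IsPotential W) {ε : ℝ} :
    ∃ q A V : ℝ → ℝ, RegularProfile N V q A ∧
      (∀ r ∈ Icc (0 : ℝ) 1, V r = 1 / ε ^ 2 * derivWithin W (Iic 1) (1 - (r * q r) ^ 2)) ∧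
      IsRadialProfile N W ε (fun r => r * q r) ∧ StrictMonoOn (fun r => r * q r) (Icc 0 1) := by
  have hN1 : 1 < N := by omega
  obtain ⟨q, hqc, hq1, hqone, hqint⟩ := exists_profile_integral_equation (n := N + 1) (by omega)
    (continuous_coefficient hW ε) (coefficient_nonneg hW ε) (coefficient_le hW ε)
    (fun x hx => coefficient_of_one_le hW ε hx)
  set V : ℝ → ℝ := fun r => coefficient W ε (r * q r) with hV
  set A : ℝ → ℝ := fun r => -radialAvg (N + 1) (fun t => q t * V t) r with hA
  have hVc : Continuous V := (continuous_coefficient hW ε).comp (by fun_prop)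
  have hkc : Continuous fun t => q t * V t := hqc.mul hVc
  have hAc : Continuous A :=
    ((continuous_radialAvg (X := Unit) (n := N + 1) (k := fun _ => fun t => q t * V t)
      (hkc.comp continuous_snd)).comp (Continuous.prodMk_right ())).neg
  have hq0 : ∀ r, 0 < q r := fun r => zero_lt_one.trans_le (hq1 r)
  have hqd : ∀ r ∈ Ioo (0 : ℝ) 1, HasDerivAt q (r * A r) r := by
    intro r hr
    have hc : Continuous fun s => s * radialAvg (N + 1) (fun t => q t * V t) s :=
      continuous_mul_radialAvg hkc
    have h1 := (intervalIntegral.integral_hasDerivAt_right (hc.intervalIntegrable 0 r)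
      (hc.stronglyMeasurableAtFilter _ _) hc.continuousAt).const_sub (q 0)
    refine (h1.congr_of_eventuallyEq ?_).congr_deriv (by simp [hA])
    filter_upwards [Icc_mem_nhds hr.1 hr.2] with x hx using hqint x hx
  have hAd : ∀ r ∈ Ioo (0 : ℝ) 1, HasDerivAt A (-(q r * V r + (N + 2) * A r) / r) r := by
    intro r hr
    refine (hasDerivAt_radialAvg hkc hr.1.ne').neg.congr_deriv ?_
    simp only [hA]
    push_cast
    ring
  set f : ℝ → ℝ := fun r => r * q r with hf
  have hfd : ∀ r ∈ Ioo (0 : ℝ) 1, HasDerivAt f (q r + r ^ 2 * A r) r := by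
    intro r hr
    refine ((hasDerivAt_id r).mul (hqd r hr)).congr_deriv ?_
    simp only [id]
    ring
  have hfd' : ∀ r ∈ Ioo (0 : ℝ) 1,
      HasDerivAt (deriv f) (-((N : ℝ) - 1) * (r * A r) - r * (q r * V r)) r := by
    intro r hr
    have h1 := (hqd r hr).add ((hasDerivAt_pow 2 r).mul (hAd r hr))
    refine (h1.congr_of_eventuallyEq ?_).congr_deriv ?_
    · filter_upwards [Ioo_mem_nhds hr.1 hr.2] with x hx using (hfd x hx).deriv
    · have := hr.1.ne'
      push_cast
      field_simp
      ring
  have hsol : SolvesRadial N V f := by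
    refine ⟨by fun_prop, fun r hr => (hfd r hr).differentiableAt,
      fun r hr => (hfd' r hr).differentiableAt, fun r hr => ?_⟩
    rw [(hfd r hr).deriv, (hfd' r hr).deriv]
    have := hr.1.ne'
    simp only [hf]
    field_simp
    ring
  have hf0 : f 0 = 0 := by simp [hf]
  have hf1 : f 1 = 1 := by simp [hf, hqone]
  have hfpos : ∀ r ∈ Ioo (0 : ℝ) 1, 0 < f r := fun r hr => mul_pos hr.1 (hq0 r)
  have hflt := hsol.lt_one hN1 hf0 hf1 fun r _ hfr => (coefficient_of_one_le hW ε hfr).le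
  have hmono := hsol.strictMonoOn hN1 hf0 hf1 hfpos hflt
    fun r _ s _ hrs => antitone_coefficient hW ε hrs
  have hfI : ∀ r ∈ Icc (0 : ℝ) 1, f r ∈ Icc (0 : ℝ) 1 := by
    intro r hr
    constructor
    · rw [← hf0]; exact hmono.monotoneOn ⟨le_rfl, zero_le_one⟩ hr hr.1
    · rw [← hf1]; exact hmono.monotoneOn hr ⟨zero_le_one, le_rfl⟩ hr.2
  have hVeq : ∀ r ∈ Icc (0 : ℝ) 1,
      V r = 1 / ε ^ 2 * derivWithin W (Iic 1) (1 - (r * q r) ^ 2) :=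
    fun r hr => coefficient_eq ε (hfI r hr)
  refine ⟨q, A, V, ?_, hVeq, ?_, hmono⟩
  · refine ⟨hVc, hqc, hAc, fun r => coefficient_nonneg hW ε _, hq1, fun r => ?_, hqone, ?_, hqd, hAd,
      fun r hr => ?_⟩
    · refine neg_nonpos.2 (intervalIntegral.integral_nonneg zero_le_one fun τ hτ => ?_)
      exact mul_nonneg (pow_nonneg hτ.1 _) (mul_nonneg (hq0 _).le (coefficient_nonneg hW ε _))
    · have := radialAvg_zero (n := N + 1) (k := fun t => q t * V t)
      simp only [hA]
      push_cast at this
      linarith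
    · rw [← (hfd r hr).deriv]
      by_contra! hneg
      have h1 : HasDerivAt f (deriv f r) r := (hfd r hr).differentiableAt.hasDerivAt
      have h2 : 0 ≤ deriv f r := by
        rw [← derivWithin_of_mem_nhds (Icc_mem_nhds hr.1 hr.2)]
        exact hmono.monotoneOn.derivWithin_nonneg
      linarith
  · refine ⟨hsol.continuousOn, fun r hr => (hfI r hr).1, hsol.differentiableAt,
      hsol.differentiableAt_deriv, fun r hr => ?_, hf0, hf1⟩
    rw [hsol.ode r hr, hVeq r (Ioo_subset_Icc_self hr)]
    ring

theorem IsRadialProfile.eqOn {N : ℕ} (hN : 3 ≤ N) {W : ℝ → ℝ} (hW : IsPotential W) {ε : ℝ}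
    {f g : ℝ → ℝ} (hf : IsRadialProfile N W ε f) (hg : IsRadialProfile N W ε g)
    (hpos : ∀ r ∈ Ioo (0 : ℝ) 1, 0 < f r) : EqOn g f (Icc 0 1) := by
  have hN1 : 1 < N := by omega
  refine (hf.solvesRadial hN1 hW).eqOn hN (hg.solvesRadial hN1 hW) (fun r hr => ?_)
    (fun r hr => hg.nonneg r (Ioo_subset_Icc_self hr)) (by rw [hf.left, hg.left])
    (by rw [hf.right, hg.right]) (fun r _ => abs_coefficient_le hW ε _)
    (fun r _ => abs_coefficient_le hW ε _) (fun r _ h => antitone_coefficient hW ε h)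
    (fun r _ h => antitone_coefficient hW ε h)
  rcases eq_or_lt_of_le hr.2 with rfl | h1
  · rw [hf.right]; exact one_pos
  · exact hpos r ⟨hr.1, h1⟩

/-! ### The Euler–Lagrange equation and coercivity on test maps -/

/-- The `i`-th partial derivative of `x ↦ q(|x|) x`, where `q' = r A`. -/
noncomputable def radialPartial {N : ℕ} (q A : ℝ → ℝ) (i : Fin N) (x : Space N) : Space N :=
  (A ‖x‖ * x i) • x + q ‖x‖ • EuclideanSpace.single i (1 : ℝ)

theorem RegularProfile.hasFDerivAt_q_norm {N : ℕ} {V q A : ℝ → ℝ} (h : RegularProfile N V q A)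
    {x : Space N} (hx : x ∈ unitBall N) :
    HasFDerivAt (fun x : Space N => q ‖x‖) (A ‖x‖ • innerSL ℝ x) x := by
  rcases eq_or_ne x 0 with rfl | hx0
  -- The equation `q' = rA` is known only for `r > 0`; the one-sided derivative at 0 is its limit,
  -- which is 0.
  · have h1 : HasDerivWithinAt q 0 (Ici 0) 0 := by
      refine hasDerivWithinAt_Ici_of_tendsto_deriv (s := Ioo 0 1)
        (fun r hr => (h.hasDerivAt_q r hr).differentiableAt.differentiableWithinAt)
        h.continuous_q.continuousWithinAt (Ioo_mem_nhdsGT one_pos) ?_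
      have hc : Continuous fun r => r * A r := continuous_id.mul h.continuous_A
      have h2 : Tendsto (fun r => r * A r) (𝓝[>] 0) (𝓝 0) := by
        simpa using (hc.tendsto 0).mono_left nhdsWithin_le_nhds
      refine h2.congr' ?_
      filter_upwards [Ioo_mem_nhdsGT (zero_lt_one' ℝ)] with r hr using (h.hasDerivAt_q r hr).deriv.symm
    have h2 : Tendsto (fun y : Space N => ‖y‖) (𝓝 0) (𝓝[≥] 0) := by
      refine tendsto_nhdsWithin_iff.2 ⟨?_, Eventually.of_forall fun y => norm_nonneg y⟩
      simpa using (continuous_norm (E := Space N)).tendsto 0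
    rw [hasDerivWithinAt_iff_isLittleO] at h1
    have h3 := h1.comp_tendsto h2
    simp only [norm_zero, map_zero, smul_zero]
    rw [hasFDerivAt_iff_isLittleO]
    have h4 : (fun y : Space N => q ‖y‖ - q 0) =o[𝓝 0] fun y : Space N => ‖y‖ := by
      simpa [Function.comp_def] using h3
    have h5 := Asymptotics.isLittleO_norm_right.1 h4
    simpa using h5
  · have hpos : 0 < ‖x‖ := norm_pos_iff.2 hx0
    have h1 := h.hasDerivAt_q ‖x‖ ⟨hpos, by simpa using hx⟩
    have h2 := hasFDerivAt_comp_norm (d := ‖x‖ ^ 2 * A ‖x‖) hx0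
      (h1.congr_deriv (by field_simp))
    refine h2.congr_fderiv ?_
    congr 1
    field_simp

theorem RegularProfile.hasFDerivAt_map {N : ℕ} {V q A : ℝ → ℝ} (h : RegularProfile N V q A)
    {x : Space N} (hx : x ∈ unitBall N) :
    HasFDerivAt (fun x : Space N => q ‖x‖ • x)
      (q ‖x‖ • ContinuousLinearMap.id ℝ (Space N) + (A ‖x‖ • innerSL ℝ x).smulRight x) x :=
  (h.hasFDerivAt_q_norm hx).smul (hasFDerivAt_id x)

theorem radialPartial_eq {N : ℕ} (q A : ℝ → ℝ) (i : Fin N) (x : Space N) :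
    (q ‖x‖ • ContinuousLinearMap.id ℝ (Space N) + (A ‖x‖ • innerSL ℝ x).smulRight x)
      (EuclideanSpace.single i (1 : ℝ)) = radialPartial q A i x := by
  simp [radialPartial, EuclideanSpace.inner_single_right, add_comm]

theorem continuous_radialPartial {N : ℕ} {q A : ℝ → ℝ} (hq : Continuous q) (hA : Continuous A)
    (i : Fin N) : Continuous (radialPartial q A i) := by
  unfold radialPartial; fun_prop

theorem tsupport_subset_of_eq_zero {X E F : Type*} [TopologicalSpace X] [Zero E] [Zero F]
    {φ : X → E} {s : X → F} (h : ∀ x, φ x = 0 → s x = 0) : tsupport s ⊆ tsupport φ :=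
  closure_mono fun x hx hφ => hx (h x hφ)

theorem sum_coord_smul_partialDeriv {N : ℕ} (φ : Space N → Space N) (x : Space N) :
    ∑ i, x i • partialDeriv i φ x = fderiv ℝ φ x x := by
  simp only [partialDeriv]
  generalize fderiv ℝ φ x = L
  conv_rhs => rw [← (EuclideanSpace.basisFun (Fin N) ℝ).sum_repr x]
  simp [map_sum]

theorem IsTestMap.continuous_partialDeriv {N : ℕ} {F : Type*} [NormedAddCommGroup F]
    [NormedSpace ℝ F] {φ : Space N → F} (hφ : IsTestMap φ) (i : Fin N) :
    Continuous (partialDeriv i φ) :=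
  (hφ.1.continuous_fderiv (by simp)).clm_apply continuous_const

/-- Second derivatives of `q(|x|) x` are avoided. With `s = ⟨φ, x⟩`, the left integrand is `A (x·∇s
- s) + q div φ`. The divergence theorem with `r A' = -(qV + (N+2)A)` turns the first term, and `∇q =
A x` turns the last, into multiples of `s`; all `A s` terms cancel and `q V s` remains. -/
theorem RegularProfile.euler_lagrange {N : ℕ} {V q A : ℝ → ℝ} (h : RegularProfile N V q A)
    {φ : Space N → Space N} (hφ : IsTestMap φ) :
    ∫ x in unitBall N, ∑ i, ⟪radialPartial q A i x, partialDeriv i φ x⟫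
      = ∫ x in unitBall N, ⟪V ‖x‖ • q ‖x‖ • x, φ x⟫ := by
  have hq := h.continuous_q
  have hA := h.continuous_A
  have hV := h.continuous_V
  have hφ1 : ContDiff ℝ 1 φ := hφ.1.of_le (by simp)
  have hφc : Continuous φ := hφ1.continuous
  have hφ' : Continuous (fderiv ℝ φ) := hφ1.continuous_fderiv one_ne_zero
  have hpd := hφ.continuous_partialDeriv
  set s : Space N → ℝ := fun x => ⟪φ x, x⟫ with hs
  have hs1 : ContDiff ℝ 1 s := hφ1.inner ℝ contDiff_id
  have hsc : Continuous s := hs1.continuous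
  have hssupp : tsupport s ⊆ unitBall N :=
    (tsupport_subset_of_eq_zero fun x hx => by simp [hs, hx]).trans hφ.2.2
  have hsd : ∀ x, fderiv ℝ s x x = ⟪fderiv ℝ φ x x, x⟫ + s x := by
    intro x
    have := ((hφ1.differentiable one_ne_zero x).hasFDerivAt.inner ℝ (hasFDerivAt_id x)).fderiv
    have e : fderiv ℝ s x = _ := this
    rw [e]
    simp [hs, add_comm]
  have hs' : Continuous fun x => fderiv ℝ s x x :=
    (hs1.continuous_fderiv one_ne_zero).clm_apply continuous_id
  have h1 := integral_ball_radial_divergence (N := N) (g := A)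
    (D := fun r => -(q r * V r + (N + 2) * A r)) hA (by fun_prop) h.hasDerivAt_A
    (by rw [h.A_zero]; ring) hs1 hssupp
  have h2 : ∀ i : Fin N, ∫ x in unitBall N, q ‖x‖ * partialDeriv i φ x i
      = -∫ x in unitBall N, A ‖x‖ * (φ x i * x i) := by
    intro i
    have hφi : ContDiff ℝ 1 fun x => φ x i :=
      (EuclideanSpace.proj i : Space N →L[ℝ] ℝ).contDiff.comp hφ1
    have hφis : tsupport (fun x => φ x i) ⊆ unitBall N :=
      (tsupport_subset_of_eq_zero fun x hx => by simp [hx]).trans hφ.2.2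
    have e : ∀ x, partialDeriv i (fun x => φ x i) x = partialDeriv i φ x i := by
      intro x
      have := ((EuclideanSpace.proj i : Space N →L[ℝ] ℝ).hasFDerivAt.comp x
        (hφ1.differentiable one_ne_zero x).hasFDerivAt).fderiv
      have e : fderiv ℝ (fun x => φ x i) x = _ := this
      rw [partialDeriv, e]
      simp [partialDeriv]
    have e2 : ∀ x : Space N, (A ‖x‖ • innerSL ℝ x) (EuclideanSpace.single i (1 : ℝ))
        = A ‖x‖ * x i := by
      intro x
      simp [EuclideanSpace.inner_single_right]
    have := integral_ball_partialDeriv_smul hφi hφis (X := fun x : Space N => q ‖x‖)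
      (fun x hx => h.hasFDerivAt_q_norm hx) i (integrableOn_ball_of_continuous (by fun_prop))
      (by simp only [e2]; exact integrableOn_ball_of_continuous (by fun_prop))
    simp only [e, e2, smul_eq_mul] at this
    rw [show (fun x : Space N => q ‖x‖ * partialDeriv i φ x i)
      = fun x => partialDeriv i φ x i * q ‖x‖ from funext fun x => mul_comm _ _, this]
    congr 2
    ext x
    ring
  have hpt : ∀ x, ∑ i, ⟪radialPartial q A i x, partialDeriv i φ x⟫
      = A ‖x‖ * fderiv ℝ s x x - A ‖x‖ * s x + ∑ i, q ‖x‖ * partialDeriv i φ x i := by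
    intro x
    have e1 : ∀ i, ⟪radialPartial q A i x, partialDeriv i φ x⟫
        = A ‖x‖ * ⟪x i • partialDeriv i φ x, x⟫ + q ‖x‖ * partialDeriv i φ x i := by
      intro i
      rw [radialPartial, inner_add_left, real_inner_smul_left, real_inner_smul_left,
        EuclideanSpace.inner_single_left, real_inner_smul_left, real_inner_comm]
      simp
      ring
    rw [Finset.sum_congr rfl fun i _ => e1 i, Finset.sum_add_distrib, ← Finset.mul_sum,
      ← sum_inner, sum_coord_smul_partialDeriv, hsd]
    ring
  have hcoord : ∀ i, Continuous fun x => partialDeriv i φ x i := fun i =>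
    (EuclideanSpace.proj i : Space N →L[ℝ] ℝ).continuous.comp (hpd i)
  have i1 : Integrable (fun x : Space N => A ‖x‖ * fderiv ℝ s x x) (ballMeasure N) :=
    integrableOn_ball_of_continuous (by fun_prop)
  have i2 : Integrable (fun x : Space N => A ‖x‖ * s x) (ballMeasure N) :=
    integrableOn_ball_of_continuous (by fun_prop)
  have i3 : ∀ i, Integrable (fun x : Space N => q ‖x‖ * partialDeriv i φ x i) (ballMeasure N) :=
    fun i => integrableOn_ball_of_continuous (by have := hcoord i; fun_prop)
  have i4 : Integrable (fun x : Space N => s x * (N * A ‖x‖ + -(q ‖x‖ * V ‖x‖ +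
      (N + 2) * A ‖x‖))) (ballMeasure N) := integrableOn_ball_of_continuous (by fun_prop)
  simp only [hpt]
  have i5 : ∀ i : Fin N, Integrable (fun x : Space N => A ‖x‖ * (φ x i * x i)) (ballMeasure N) :=
    fun i => integrableOn_ball_of_continuous (by fun_prop)
  have i12 : Integrable (fun x : Space N => A ‖x‖ * fderiv ℝ s x x - A ‖x‖ * s x)
      (ballMeasure N) := i1.sub i2
  have i3s : Integrable (fun x : Space N => ∑ i, q ‖x‖ * partialDeriv i φ x i)
      (ballMeasure N) := integrable_finsetSum _ fun i _ => i3 i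
  rw [integral_add i12 i3s, integral_sub i1 i2, h1,
    integral_finsetSum _ fun i _ => i3 i, Finset.sum_congr rfl fun i _ => h2 i,
    Finset.sum_neg_distrib, ← integral_finsetSum _ fun i _ => i5 i]
  have e5 : ∀ x : Space N, ∑ i, A ‖x‖ * (φ x i * x i) = A ‖x‖ * s x := by
    intro x
    rw [← Finset.mul_sum, hs]
    simp [PiLp.inner_apply, mul_comm]
  simp only [e5]
  have i4n : Integrable (fun x : Space N => -(s x * (N * A ‖x‖ + -(q ‖x‖ * V ‖x‖ +
      (N + 2) * A ‖x‖)))) (ballMeasure N) := i4.neg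
  have i42 : Integrable (fun x : Space N => -(s x * (N * A ‖x‖ + -(q ‖x‖ * V ‖x‖ +
      (N + 2) * A ‖x‖))) - A ‖x‖ * s x) (ballMeasure N) := i4n.sub i2
  rw [← integral_neg, ← integral_sub i4n i2, ← sub_eq_add_neg, ← integral_sub i42 i2]
  refine integral_congr_ae (Eventually.of_forall fun x => ?_)
  simp only [real_inner_smul_left, hs, real_inner_comm x (φ x)]
  ring

/-! ### Hardy-type coercivity of the second variation. -/

/-- Here `b = A/q`, and the right side is `-Δψ/ψ` for `ψ = q (r² + d)^(-3/4)`. For an exponent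
`-α/2`, the worst case `r² b = -1` with `d → 0` leaves `(α(N-4) - α² - 2)/r²` besides `v`; this is
positive for some `α` exactly when `(N-4)² > 8` and `N > 4`, that is `N ≥ 7`, and `α = 3/2` is
optimal for `N = 7`. -/
theorem coercivity_pointwise {N : ℕ} (hN : 7 ≤ N) {b C d r v : ℝ} (hd0 : 0 < d) (hd1 : d ≤ 1)
    (hdC : 40 * (d * C) ≤ 1) (hr1 : r < 1) (hr0 : 0 ≤ r) (hb0 : b ≤ 0) (hbC : -C ≤ b)
    (hrb : -1 ≤ r ^ 2 * b) :
    v + 1 / 16 ≤ v + 2 * b + 3 * (r ^ 2 * (1 / (r ^ 2 + d))) * b + 3 / 2 * N * (1 / (r ^ 2 + d))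
      - 21 / 4 * (r ^ 2 * (1 / (r ^ 2 + d))) * (1 / (r ^ 2 + d)) := by
  have hρ0 : 0 < r ^ 2 + d := by positivity
  set t := 1 / (r ^ 2 + d) with ht
  have ht0 : 0 < t := by positivity
  have htρ : t * (r ^ 2 + d) = 1 := by rw [ht]; field_simp
  have hr2t : r ^ 2 * t ≤ 1 := by
    have := mul_pos ht0 hd0
    linarith
  have hr2t0 : 0 ≤ r ^ 2 * t := by positivity
  have hNR : (7 : ℝ) ≤ N := by exact_mod_cast hN
  -- Adding `r² b ≥ -1` and `d b ≥ -1/40` bounds `b` by a multiple of `t`. The coefficients of `t`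
  -- then add up to at least `21/2 - 21/4 - 5·41/40 = 1/8`, and `t ≥ 1/2` gives `1/16`.
  have hbt : -(1 + 1 / 40) * t ≤ b := by
    have h2 : d * -C ≤ d * b := mul_le_mul_of_nonneg_left hbC hd0.le
    have h1 : -(1 + 1 / 40) ≤ b * (r ^ 2 + d) := by linarith
    calc -(1 + 1 / 40) * t ≤ b * (r ^ 2 + d) * t := mul_le_mul_of_nonneg_right h1 ht0.le
      _ = b := by rw [mul_assoc, mul_comm _ t, htρ, mul_one]
  have ht2 : 1 / 2 ≤ t := by
    have h1 : r ^ 2 ≤ 1 := pow_le_one₀ hr0 hr1.le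
    rw [ht]
    exact one_div_le_one_div_of_le hρ0 (by linarith)
  have h1 : 1 * b ≤ (r ^ 2 * t) * b := mul_le_mul_of_nonpos_right hr2t hb0
  have h2 : (r ^ 2 * t) * t ≤ 1 * t := mul_le_mul_of_nonneg_right hr2t ht0.le
  have h3 : 7 * t ≤ N * t := mul_le_mul_of_nonneg_right hNR ht0.le
  linarith

/-- For `ψ > 0` with `-Δψ ≥ (V + κ)ψ`, integrating `|∇φ - φ ∇ψ/ψ|² ≥ 0` by parts gives the claim.
Only the field `∇ψ/ψ = g(|x|) x` is needed, not `ψ` itself. -/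
theorem RegularProfile.coercive {N : ℕ} (hN : 7 ≤ N) {V q A : ℝ → ℝ}
    (h : RegularProfile N V q A) : ∃ κ > 0, ∀ φ : Space N → Space N, IsTestMap φ →
      ∫ x in unitBall N, (V ‖x‖ + κ) * ‖φ x‖ ^ 2
        ≤ ∫ x in unitBall N, ∑ i, ‖partialDeriv i φ x‖ ^ 2 := by
  have hq := h.continuous_q
  have hA := h.continuous_A
  have hV := h.continuous_V
  have hq0 : ∀ r, 0 < q r := fun r => zero_lt_one.trans_le (h.one_le r)
  obtain ⟨C₀, hC₀⟩ := (isCompact_Icc (a := (0 : ℝ)) (b := 1)).exists_bound_of_continuousOn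
    hA.continuousOn
  set C := max C₀ 1 with hC
  have hC1 : 1 ≤ C := le_max_right _ _
  -- `d > 0` keeps the Hardy factor regular at the origin; its size makes the bound `d |A| ≤ 1/40`
  -- fit the slack left at `N = 7`.
  set d : ℝ := 1 / (40 * C) with hd
  have hd0 : 0 < d := by positivity
  have hdC : 40 * (d * C) = 1 := by rw [hd]; field_simp
  have hd1 : d ≤ 1 := by nlinarith
  refine ⟨1 / 16, by norm_num, fun φ hφ => ?_⟩
  have hφ1 : ContDiff ℝ 1 φ := hφ.1.of_le (by simp)
  have hφc : Continuous φ := hφ1.continuous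
  have hφ' : Continuous (fderiv ℝ φ) := hφ1.continuous_fderiv one_ne_zero
  have hpd := hφ.continuous_partialDeriv
  -- `r g(r)` is the logarithmic derivative of `q (r² + d)^(-3/4)`, and `D = r g'`.
  set g : ℝ → ℝ := fun r => A r / q r - (3 / 2) / (r ^ 2 + d) with hg
  set D : ℝ → ℝ := fun r => -(q r * V r + (N + 2) * A r) / q r - r ^ 2 * A r ^ 2 / q r ^ 2
    + 3 * r ^ 2 / (r ^ 2 + d) ^ 2 with hD
  have hρ : ∀ r : ℝ, 0 < r ^ 2 + d := fun r => by positivity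
  have hgc : Continuous g := by
    have h1 : ∀ r, q r ≠ 0 := fun r => (hq0 r).ne'
    have h2 : ∀ r : ℝ, r ^ 2 + d ≠ 0 := fun r => (hρ r).ne'
    fun_prop (disch := assumption)
  have hDc : Continuous D := by
    have h1 : ∀ r, q r ≠ 0 := fun r => (hq0 r).ne'
    have h1' : ∀ r, q r ^ 2 ≠ 0 := fun r => pow_ne_zero _ (hq0 r).ne'
    have h2 : ∀ r : ℝ, (r ^ 2 + d) ^ 2 ≠ 0 := fun r => pow_ne_zero _ (hρ r).ne'
    fun_prop (disch := assumption)
  have hgd : ∀ r ∈ Ioo (0 : ℝ) 1, HasDerivAt g (D r / r) r := by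
    intro r hr
    have h1 := (h.hasDerivAt_A r hr).div (h.hasDerivAt_q r hr) (hq0 r).ne'
    have h2 := ((hasDerivAt_const r (3 / 2 : ℝ)).div ((hasDerivAt_pow 2 r).add_const d) (hρ r).ne')
    refine (h1.sub h2).congr_deriv ?_
    have := hr.1.ne'
    have := (hq0 r).ne'
    have := (hρ r).ne'
    simp only [hD]
    field_simp
    push_cast
    ring
  have hD0 : D 0 = 0 := by
    simp only [hD]
    rw [h.A_zero]
    simp
  set s : Space N → ℝ := fun x => ‖φ x‖ ^ 2 with hs
  have hs1 : ContDiff ℝ 1 s := hφ1.norm_sq ℝ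
  have hssupp : tsupport s ⊆ unitBall N :=
    (tsupport_subset_of_eq_zero fun x hx => by simp [hs, hx]).trans hφ.2.2
  have hsd : ∀ x, fderiv ℝ s x x = 2 * ⟪φ x, fderiv ℝ φ x x⟫ := by
    intro x
    have := ((hφ1.differentiable one_ne_zero x).hasFDerivAt.norm_sq).fderiv
    have e : fderiv ℝ s x = _ := this
    rw [e]
    simp
  have hsc : Continuous s := hs1.continuous
  have hs' : Continuous fun x => fderiv ℝ s x x :=
    (hs1.continuous_fderiv one_ne_zero).clm_apply continuous_id
  have hdiv := integral_ball_radial_divergence (N := N) hgc hDc hgd hD0 hs1 hssupp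
  have hpt : ∀ x, g ‖x‖ * fderiv ℝ s x x - (‖x‖ * g ‖x‖) ^ 2 * s x
      ≤ ∑ i, ‖partialDeriv i φ x‖ ^ 2 := by
    intro x
    have h0 : 0 ≤ ∑ i, ‖partialDeriv i φ x - (g ‖x‖ * x i) • φ x‖ ^ 2 :=
      Finset.sum_nonneg fun i _ => sq_nonneg _
    have e : ∀ i, ‖partialDeriv i φ x - (g ‖x‖ * x i) • φ x‖ ^ 2 = ‖partialDeriv i φ x‖ ^ 2
        - 2 * g ‖x‖ * ⟪x i • partialDeriv i φ x, φ x⟫ + x i ^ 2 * (g ‖x‖ ^ 2 * s x) := by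
      intro i
      rw [norm_sub_sq_real, norm_smul, mul_pow, Real.norm_eq_abs, sq_abs, real_inner_smul_right,
        real_inner_smul_left]
      ring
    have hx2 : ∑ i, x i ^ 2 = ‖x‖ ^ 2 := by rw [EuclideanSpace.norm_sq_eq]; simp
    rw [Finset.sum_congr rfl fun i _ => e i, Finset.sum_add_distrib, Finset.sum_sub_distrib,
      ← Finset.mul_sum, ← sum_inner, sum_coord_smul_partialDeriv, ← Finset.sum_mul, hx2] at h0
    rw [hsd, real_inner_comm]
    nlinarith
  have hpt2 : ∀ x ∈ unitBall N, (V ‖x‖ + 1 / 16) * s x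
      ≤ -(s x * (N * g ‖x‖ + D ‖x‖)) - (‖x‖ * g ‖x‖) ^ 2 * s x := by
    intro x hx
    have hx1 : ‖x‖ < 1 := by simpa using hx
    set r := ‖x‖ with hr
    have hr0 : 0 ≤ r := norm_nonneg x
    have hmain : V r + 1 / 16 ≤ -(N * g r + D r) - (r * g r) ^ 2 := by
      have hqr := hq0 r
      have h1 := hC₀ r ⟨hr0, hx1.le⟩
      rw [Real.norm_eq_abs, abs_of_nonpos (h.A_nonpos r)] at h1
      have h2 : C₀ ≤ C := le_max_left _ _
      refine (coercivity_pointwise hN (b := A r / q r) (C := C) (d := d) (r := r) (v := V r) hd0 hd1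
        hdC.le hx1 hr0 (div_nonpos_of_nonpos_of_nonneg (h.A_nonpos r) hqr.le) ?_ ?_).trans_eq ?_
      · rw [le_div_iff₀ hqr]
        have h3 : C * 1 ≤ C * q r := mul_le_mul_of_nonneg_left (h.one_le r) (by linarith)
        linarith
      · rcases eq_or_lt_of_le hr0 with h0 | h0
        · rw [← h0]; norm_num
        · have := h.deriv_nonneg r ⟨h0, hx1⟩
          rw [← mul_div_assoc, le_div_iff₀ hqr]
          linarith
      · simp only [hg, hD]
        have := hρ r
        field_simp
        ring
    have hs0 : 0 ≤ s x := sq_nonneg _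
    calc (V r + 1 / 16) * s x ≤ (-(N * g r + D r) - (r * g r) ^ 2) * s x :=
          mul_le_mul_of_nonneg_right hmain hs0
      _ = _ := by ring
  have i1 : Integrable (fun x : Space N => g ‖x‖ * fderiv ℝ s x x) (ballMeasure N) :=
    integrableOn_ball_of_continuous (by fun_prop)
  have i2 : Integrable (fun x : Space N => (‖x‖ * g ‖x‖) ^ 2 * s x) (ballMeasure N) :=
    integrableOn_ball_of_continuous (by fun_prop)
  have i3 : Integrable (fun x : Space N => s x * (N * g ‖x‖ + D ‖x‖)) (ballMeasure N) :=
    integrableOn_ball_of_continuous (by fun_prop)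
  have i4 : Integrable (fun x : Space N => (V ‖x‖ + 1 / 16) * s x) (ballMeasure N) :=
    integrableOn_ball_of_continuous (by fun_prop)
  have i5 : Integrable (fun x : Space N => ∑ i, ‖partialDeriv i φ x‖ ^ 2) (ballMeasure N) :=
    integrableOn_ball_of_continuous (by fun_prop)
  have i3n : Integrable (fun x : Space N => -(s x * (N * g ‖x‖ + D ‖x‖))) (ballMeasure N) := i3.neg
  have i32 : IntegrableOn (fun x : Space N => -(s x * (N * g ‖x‖ + D ‖x‖))
      - (‖x‖ * g ‖x‖) ^ 2 * s x) (unitBall N) := i3n.sub i2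
  have i12 : Integrable (fun x : Space N => g ‖x‖ * fderiv ℝ s x x - (‖x‖ * g ‖x‖) ^ 2 * s x)
      (ballMeasure N) := i1.sub i2
  calc ∫ x in unitBall N, (V ‖x‖ + 1 / 16) * s x
      ≤ ∫ x in unitBall N, (-(s x * (N * g ‖x‖ + D ‖x‖)) - (‖x‖ * g ‖x‖) ^ 2 * s x) :=
        setIntegral_mono_on i4 i32 Metric.isOpen_ball.measurableSet hpt2
    _ = ∫ x in unitBall N, (g ‖x‖ * fderiv ℝ s x x - (‖x‖ * g ‖x‖) ^ 2 * s x) := by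
        rw [integral_sub i3n i2, integral_sub i1 i2, hdiv, integral_neg]
    _ ≤ _ := integral_mono i12 i5 hpt

/-! ### Admissibility of the radial map -/

theorem tendsto_eLpNorm_zero_of_bounded {N : ℕ} {F : ℕ → Space N → Space N} {C : ℝ}
    (hF : ∀ n, Continuous (F n)) (hC : ∀ n, ∀ x ∈ unitBall N, ‖F n x‖ ≤ C)
    (hlim : ∀ x ∈ unitBall N, Tendsto (fun n => F n x) atTop (𝓝 0)) :
    Tendsto (fun n => eLpNorm (F n) 2 (ballMeasure N)) atTop (𝓝 0) := by
  have hball : ∀ᵐ x ∂ballMeasure N, x ∈ unitBall N :=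
    ae_restrict_mem Metric.isOpen_ball.measurableSet
  have h1 : Tendsto (fun n => ∫⁻ x, ‖F n x‖ₑ ^ (2 : ℝ) ∂ballMeasure N) atTop
      (𝓝 (∫⁻ _, 0 ∂ballMeasure N)) := by
    refine tendsto_lintegral_of_dominated_convergence (fun _ => ENNReal.ofReal C ^ (2 : ℝ))
      (fun n => ((hF n).enorm.measurable.pow_const _)) (fun n => ?_) ?_ ?_
    · filter_upwards [hball] with x hx
      refine ENNReal.rpow_le_rpow ?_ (by norm_num)
      rw [← ofReal_norm]
      exact ENNReal.ofReal_le_ofReal (hC n x hx)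
    · rw [lintegral_const]
      exact ENNReal.mul_ne_top (ENNReal.rpow_ne_top_of_nonneg (by norm_num) ENNReal.ofReal_ne_top)
        (measure_ne_top _ _)
    · filter_upwards [hball] with x hx
      have h2 := (hlim x hx).enorm
      have h3 := (ENNReal.continuous_rpow_const (y := (2 : ℝ))).tendsto (‖(0 : Space N)‖ₑ)
      simpa [Function.comp_def] using h3.comp h2
  have h2 := ((ENNReal.continuous_rpow_const (y := (1 / 2 : ℝ))).tendsto _).comp h1
  simp only [lintegral_zero] at h2
  rw [ENNReal.zero_rpow_of_pos (by norm_num)] at h2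
  refine h2.congr fun n => ?_
  rw [eLpNorm_eq_lintegral_rpow_enorm_toReal (by norm_num) (by norm_num)]
  simp

/-- Uniformly bounded smooth functions, vanishing near `1`, converging to `a` on `[0,1)`. -/
theorem exists_smooth_cutoff_approx {a : ℝ → ℝ} (ha : Continuous a) :
    ∃ (g : ℕ → ℝ → ℝ) (C : ℝ), (∀ n, ContDiff ℝ ∞ (g n)) ∧
      (∀ n, ∀ s ∈ Icc (0 : ℝ) 1, |g n s| ≤ C) ∧
      (∀ n : ℕ, ∀ s : ℝ, 1 - 1 / ((n : ℝ) + 1) ≤ s → g n s = 0) ∧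
      ∀ s ∈ Ico (0 : ℝ) 1, Tendsto (fun n => g n s) atTop (𝓝 (a s)) := by
  obtain ⟨K, hK⟩ := (isCompact_Icc (a := (0 : ℝ)) (b := 1)).exists_bound_of_continuousOn
    ha.continuousOn
  choose p hp using fun n : ℕ => exists_polynomial_near_of_continuousOn 0 1 a ha.continuousOn
    (1 / ((n : ℝ) + 1)) (by positivity)
  have hpc : ∀ n, ContDiff ℝ ∞ fun s => (p n).eval s := fun n => by
    simpa using (p n).contDiff_aeval (𝕜 := ℝ) (R := ℝ) ∞
  refine ⟨fun n s => (p n).eval s * Real.smoothTransition ((1 - s) * (n + 1) - 1), K + 1,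
    fun n => ?_, fun n s hs => ?_, fun n s hs => ?_, fun s hs => ?_⟩
  · exact (hpc n).mul (Real.smoothTransition.contDiff.comp (by fun_prop))
  · rw [abs_mul, abs_of_nonneg (Real.smoothTransition.nonneg _)]
    have h1 : |(p n).eval s| ≤ K + 1 := by
      have h2 := (hp n s hs).le
      have h3 : 1 / ((n : ℝ) + 1) ≤ 1 := by
        rw [div_le_one (by positivity)]; linarith [n.cast_nonneg (α := ℝ)]
      have h4 := hK s hs
      rw [Real.norm_eq_abs] at h4
      calc |(p n).eval s| = |((p n).eval s - a s) + a s| := by ring_nf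
        _ ≤ |(p n).eval s - a s| + |a s| := abs_add_le _ _
        _ ≤ _ := by linarith
    calc _ ≤ |(p n).eval s| * 1 := by
          gcongr
          exact Real.smoothTransition.le_one _
      _ ≤ _ := by simpa using h1
  · have h1 : (1 - s) * ((n : ℝ) + 1) ≤ 1 := by
      have h2 : 1 - s ≤ 1 / ((n : ℝ) + 1) := by linarith
      rwa [le_div_iff₀ (by positivity)] at h2
    simp only
    rw [Real.smoothTransition.zero_of_nonpos (by linarith), mul_zero]
  · have h1 : Tendsto (fun n => (p n).eval s) atTop (𝓝 (a s)) := by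
      refine tendsto_iff_dist_tendsto_zero.2 (squeeze_zero (fun _ => dist_nonneg)
        (fun n => (hp n s ⟨hs.1, hs.2.le⟩).le) tendsto_one_div_add_atTop_nhds_zero_nat)
    have h2 : ∀ᶠ n : ℕ in atTop, Real.smoothTransition ((1 - s) * ((n : ℝ) + 1) - 1) = 1 := by
      obtain ⟨m, hm⟩ := exists_nat_ge (2 / (1 - s))
      filter_upwards [eventually_ge_atTop m] with n hn
      have h3 : (m : ℝ) ≤ n := by exact_mod_cast hn
      have h4 : 0 < 1 - s := by linarith [hs.2]
      rw [div_le_iff₀ h4] at hm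
      exact Real.smoothTransition.one_of_one_le (by nlinarith)
    refine h1.congr' ?_
    filter_upwards [h2] with n hn
    rw [hn, mul_one]

theorem contDiff_primitive {g : ℝ → ℝ} (hg : ContDiff ℝ ∞ g) :
    ContDiff ℝ ∞ (fun s => ∫ t in (1 : ℝ)..s, g t) := by
  have hd : ∀ s, HasDerivAt (fun s => ∫ t in (1 : ℝ)..s, g t) (g s) s := fun s =>
    intervalIntegral.integral_hasDerivAt_right (hg.continuous.intervalIntegrable _ _)
      (hg.continuous.stronglyMeasurableAtFilter _ _) hg.continuous.continuousAt
  rw [contDiff_infty_iff_deriv]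
  refine ⟨fun s => (hd s).differentiableAt, ?_⟩
  rwa [show deriv (fun s => ∫ t in (1 : ℝ)..s, g t) = g from funext fun s => (hd s).deriv]

/-- Expresses `q(|x|) - 1` as a primitive in the smooth variable `s = |x|²`, vanishing at `s = 1`.
-/
theorem RegularProfile.integral_half_A_sqrt {N : ℕ} {V q A : ℝ → ℝ} (h : RegularProfile N V q A)
    {s : ℝ} (hs : s ∈ Icc (0 : ℝ) 1) :
    ∫ t in (1 : ℝ)..s, A (√t) / 2 = q (√s) - 1 := by
  have hq := h.continuous_q
  have hA := h.continuous_A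
  rw [intervalIntegral.integral_symm, intervalIntegral.integral_eq_sub_of_hasDerivAt_of_le
    (f := fun t => q (√t)) hs.2 (by fun_prop)]
  · simp [h.q_one]
  · intro t ht
    have ht0 : 0 < t := hs.1.trans_lt ht.1
    have hst : √t ∈ Ioo (0 : ℝ) 1 := ⟨Real.sqrt_pos.2 ht0, by
      rw [Real.sqrt_lt' one_pos]; simpa using ht.2⟩
    refine ((h.hasDerivAt_q _ hst).comp t (Real.hasDerivAt_sqrt ht0.ne')).congr_deriv ?_
    have := hst.1.ne'
    field_simp
  · exact Continuous.intervalIntegrable (by fun_prop) _ _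

theorem MemH1.weakPartial_ae_eq {N : ℕ} {u g : Space N → Space N} {i : Fin N} (hu : MemH1 u)
    (hg : IsWeakPartial i u g) : weakPartial i u =ᵐ[ballMeasure N] g :=
  (hu.isWeakPartial i).ae_eq (EventuallyEq.refl _ _) hg

theorem isWeakPartial_id {N : ℕ} (i : Fin N) :
    IsWeakPartial i (fun x : Space N => x) (fun _ => EuclideanSpace.single i (1 : ℝ)) :=
  isWeakPartial_of_hasFDerivAt (u' := fun _ => ContinuousLinearMap.id ℝ (Space N)) continuous_id
    (fun x _ => hasFDerivAt_id x) i (memLp_ball_of_continuous continuous_const 2)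

theorem RegularProfile.isWeakPartial {N : ℕ} {V q A : ℝ → ℝ} (h : RegularProfile N V q A)
    (i : Fin N) : IsWeakPartial i (fun x : Space N => q ‖x‖ • x) (radialPartial q A i) := by
  have hq := h.continuous_q
  have := isWeakPartial_of_hasFDerivAt (u := fun x : Space N => q ‖x‖ • x) (by fun_prop)
    (fun x hx => h.hasFDerivAt_map hx) i (by
      simp only [radialPartial_eq]
      exact memLp_ball_of_continuous (continuous_radialPartial hq h.continuous_A i) 2)
  simpa only [radialPartial_eq] using this

theorem RegularProfile.memH1 {N : ℕ} {V q A : ℝ → ℝ} (h : RegularProfile N V q A) :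
    MemH1 (fun x : Space N => q ‖x‖ • x) := by
  have hq := h.continuous_q
  exact ⟨memLp_ball_of_continuous (by fun_prop) 2, fun i => ⟨_, h.isWeakPartial i⟩⟩

theorem RegularProfile.isWeakPartial_sub_id {N : ℕ} {V q A : ℝ → ℝ} (h : RegularProfile N V q A)
    (i : Fin N) : IsWeakPartial i (fun x : Space N => q ‖x‖ • x - x)
      (fun x => radialPartial q A i x - EuclideanSpace.single i (1 : ℝ)) :=
  (h.isWeakPartial i).sub h.memH1.1 (memLp_ball_of_continuous continuous_id 2) (isWeakPartial_id i)

/-- Smoothing `A(√s)/2` and cutting it off near `s = 1` before integrating from 1 gives primitives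
`P n` that vanish near the boundary. Approximating the derivative makes both the maps and their
gradients converge boundedly and pointwise, and no derivative falls on the cutoff. -/
theorem RegularProfile.memH10 {N : ℕ} {V q A : ℝ → ℝ} (h : RegularProfile N V q A) :
    MemH10 (fun x : Space N => q ‖x‖ • x - x) := by
  have hq := h.continuous_q
  have hA := h.continuous_A
  have hH1 : MemH1 (fun x : Space N => q ‖x‖ • x - x) :=
    ⟨memLp_ball_of_continuous (by fun_prop) 2, fun i => ⟨_, h.isWeakPartial_sub_id i⟩⟩
  refine ⟨hH1, ?_⟩
  obtain ⟨g, C, hg, hgC, hg0, hglim⟩ := exists_smooth_cutoff_approx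
    (a := fun s => A (√s) / 2) (by fun_prop)
  have hC0 : 0 ≤ C := (abs_nonneg _).trans (hgC 0 0 ⟨le_rfl, zero_le_one⟩)
  set P : ℕ → ℝ → ℝ := fun n s => ∫ t in (1 : ℝ)..s, g n t with hP
  have hPs : ∀ n, ContDiff ℝ ∞ (P n) := fun n => contDiff_primitive (hg n)
  have hPc : ∀ n, Continuous (P n) := fun n => (hPs n).continuous
  have hgc : ∀ n, Continuous (g n) := fun n => (hg n).continuous
  have hPd : ∀ n s, HasDerivAt (P n) (g n s) s := fun n s =>
    intervalIntegral.integral_hasDerivAt_right ((hgc n).intervalIntegrable _ _)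
      ((hgc n).stronglyMeasurableAtFilter _ _) (hgc n).continuousAt
  have hP0 : ∀ (n : ℕ) (s : ℝ), 1 - 1 / ((n : ℝ) + 1) ≤ s → P n s = 0 := by
    intro n s hs
    refine intervalIntegral.integral_zero_ae (Eventually.of_forall fun t ht => hg0 n t ?_)
    have h1 : (0 : ℝ) < 1 / ((n : ℝ) + 1) := by positivity
    rcases le_total 1 s with h2 | h2
    · rw [uIoc_of_le h2] at ht; linarith [ht.1]
    · rw [uIoc_of_ge h2] at ht; linarith [ht.1]
  have hPC : ∀ n, ∀ s ∈ Icc (0 : ℝ) 1, |P n s| ≤ C := by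
    intro n s hs
    have h1 := intervalIntegral.norm_integral_le_of_norm_le_const (a := 1) (b := s) (f := g n)
      (C := C) fun t ht => by
        rw [uIoc_of_ge hs.2] at ht
        exact hgC n t ⟨hs.1.trans ht.1.le, ht.2⟩
    refine h1.trans ?_
    rw [abs_of_nonpos (by linarith [hs.2])]
    nlinarith [hs.1]
  have hPlim : ∀ s ∈ Ico (0 : ℝ) 1, Tendsto (fun n => P n s) atTop (𝓝 (q (√s) - 1)) := by
    intro s hs
    rw [← h.integral_half_A_sqrt ⟨hs.1, hs.2.le⟩]
    refine intervalIntegral.tendsto_integral_filter_of_dominated_convergence (fun _ => C) ?_ ?_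
      (by simp) ?_
    · exact Eventually.of_forall fun n => (hgc n).aestronglyMeasurable
    · refine Eventually.of_forall fun n => Eventually.of_forall fun t ht => ?_
      rw [uIoc_of_ge hs.2.le] at ht
      exact hgC n t ⟨hs.1.trans ht.1.le, ht.2⟩
    · have hne : ∀ᵐ t : ℝ, t ≠ 1 := by simp [ae_iff]
      filter_upwards [hne] with t ht1 ht
      rw [uIoc_of_ge hs.2.le] at ht
      exact hglim t ⟨hs.1.trans ht.1.le, lt_of_le_of_ne ht.2 ht1⟩
  -- Taking `P n` at `|x|²`, not `|x|`, makes the map smooth at the origin.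
  set φ : ℕ → Space N → Space N := fun n x => P n (‖x‖ ^ 2) • x with hφ
  have hφd : ∀ n i x, partialDeriv i (φ n) x
      = (2 * g n (‖x‖ ^ 2) * x i) • x + P n (‖x‖ ^ 2) • EuclideanSpace.single i (1 : ℝ) := by
    intro n i x
    have h1 := (((hPd n (‖x‖ ^ 2)).comp_hasFDerivAt x
      (hasStrictFDerivAt_norm_sq x).hasFDerivAt).smul (hasFDerivAt_id x)).fderiv
    have e : fderiv ℝ (φ n) x = _ := h1
    rw [partialDeriv, e]
    simp [EuclideanSpace.inner_single_right, add_comm]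
    congr 1
    ring
  have hφt : ∀ n, IsTestMap (φ n) := by
    intro n
    have hpos : (0 : ℝ) < 1 / ((n : ℝ) + 1) := by positivity
    have hsub : tsupport (φ n) ⊆ Metric.closedBall 0 (√(1 - 1 / ((n : ℝ) + 1))) := by
      refine closure_minimal (fun x hx => ?_) Metric.isClosed_closedBall
      by_contra hx'
      rw [mem_closedBall_zero_iff, not_le] at hx'
      refine hx ?_
      have : 1 - 1 / ((n : ℝ) + 1) ≤ ‖x‖ ^ 2 := ((Real.sqrt_lt' ((Real.sqrt_nonneg _).trans_lt hx')).1
        hx').le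
      simp [hφ, hP0 n _ this]
    refine ⟨((hPs n).comp (contDiff_norm_sq ℝ)).smul contDiff_id,
      (isCompact_closedBall _ _).of_isClosed_subset (isClosed_tsupport _) hsub, hsub.trans ?_⟩
    refine Metric.closedBall_subset_ball ?_
    rw [Real.sqrt_lt' one_pos]
    linarith
  obtain ⟨KA, hKA⟩ := (isCompact_Icc (a := (0 : ℝ)) (b := 1)).exists_bound_of_continuousOn
    hA.continuousOn
  obtain ⟨Kq, hKq⟩ := (isCompact_Icc (a := (0 : ℝ)) (b := 1)).exists_bound_of_continuousOn
    (f := fun r => q r - 1) (by fun_prop)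
  have hball : ∀ x ∈ unitBall N, ‖x‖ ∈ Ico (0 : ℝ) 1 ∧ ‖x‖ ^ 2 ∈ Ico (0 : ℝ) 1 := by
    intro x hx
    have hx1 : ‖x‖ < 1 := by simpa using hx
    exact ⟨⟨norm_nonneg x, hx1⟩, sq_nonneg _, pow_lt_one₀ (norm_nonneg x) hx1 two_ne_zero⟩
  have hPx : ∀ x ∈ unitBall N, Tendsto (fun n => (q ‖x‖ - 1) - P n (‖x‖ ^ 2)) atTop (𝓝 0) := by
    intro x hx
    have := (hPlim _ (hball x hx).2).const_sub (q ‖x‖ - 1)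
    simpa [Real.sqrt_sq (norm_nonneg x)] using this
  have hgx : ∀ x ∈ unitBall N, Tendsto (fun n => A ‖x‖ - 2 * g n (‖x‖ ^ 2)) atTop (𝓝 0) := by
    intro x hx
    have := ((hglim _ (hball x hx).2).const_mul 2).const_sub (A ‖x‖)
    simp only [Real.sqrt_sq (norm_nonneg x)] at this
    convert this using 2
    ring
  have hPb : ∀ n, ∀ x ∈ unitBall N, |(q ‖x‖ - 1) - P n (‖x‖ ^ 2)| ≤ Kq + C := by
    intro n x hx
    obtain ⟨h1, h2⟩ := hball x hx
    exact (abs_sub _ _).trans (add_le_add (hKq _ ⟨h1.1, h1.2.le⟩) (hPC n _ ⟨h2.1, h2.2.le⟩))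
  have hgb : ∀ n, ∀ x ∈ unitBall N, |A ‖x‖ - 2 * g n (‖x‖ ^ 2)| ≤ KA + 2 * C := by
    intro n x hx
    obtain ⟨h1, h2⟩ := hball x hx
    refine (abs_sub _ _).trans (add_le_add (hKA _ ⟨h1.1, h1.2.le⟩) ?_)
    rw [abs_mul, abs_two]
    linarith [hgC n _ ⟨h2.1, h2.2.le⟩]
  have hlim0 : Tendsto (fun n => eLpNorm (fun x : Space N => (q ‖x‖ • x - x) - φ n x) 2
      (ballMeasure N)) atTop (𝓝 0) := by
    have e : ∀ n (x : Space N), (q ‖x‖ • x - x) - φ n x = ((q ‖x‖ - 1) - P n (‖x‖ ^ 2)) • x := by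
      intro n x
      simp only [hφ, sub_smul, one_smul]
    simp only [e]
    refine tendsto_eLpNorm_zero_of_bounded (C := (Kq + C) * 1) (fun n => by
      have := hPc n; fun_prop) (fun n x hx => ?_) (fun x hx => ?_)
    · rw [norm_smul]
      exact mul_le_mul (hPb n x hx) (hball x hx).1.2.le (norm_nonneg _)
        ((abs_nonneg _).trans (hPb n x hx))
    · simpa using (hPx x hx).smul_const x
  have hlim1 : ∀ i, Tendsto (fun n => eLpNorm (fun x : Space N =>
      weakPartial i (fun x : Space N => q ‖x‖ • x - x) x - partialDeriv i (φ n) x) 2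
      (ballMeasure N)) atTop (𝓝 0) := by
    intro i
    have hae := hH1.weakPartial_ae_eq (h.isWeakPartial_sub_id i)
    have e : ∀ n (x : Space N), (radialPartial q A i x - EuclideanSpace.single i (1 : ℝ))
        - partialDeriv i (φ n) x = ((A ‖x‖ - 2 * g n (‖x‖ ^ 2)) * x i) • x
          + ((q ‖x‖ - 1) - P n (‖x‖ ^ 2)) • EuclideanSpace.single i (1 : ℝ) := by
      intro n x
      rw [hφd, radialPartial]
      module
    have e' : ∀ n, eLpNorm (fun x : Space N =>
        weakPartial i (fun x : Space N => q ‖x‖ • x - x) x - partialDeriv i (φ n) x) 2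
        (ballMeasure N) = eLpNorm (fun x : Space N => ((A ‖x‖ - 2 * g n (‖x‖ ^ 2)) * x i) • x
          + ((q ‖x‖ - 1) - P n (‖x‖ ^ 2)) • EuclideanSpace.single i (1 : ℝ)) 2
        (ballMeasure N) := by
      intro n
      refine eLpNorm_congr_ae ?_
      filter_upwards [hae] with x hx
      rw [hx, e]
    simp only [e']
    refine tendsto_eLpNorm_zero_of_bounded (C := (KA + 2 * C) * 1 * 1 + (Kq + C)) (fun n => by
      have := hPc n; have := hgc n; fun_prop) (fun n x hx => ?_) (fun x hx => ?_)
    · have hx1 := (hball x hx).1.2.le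
      refine (norm_add_le _ _).trans (add_le_add ?_ ?_)
      · rw [norm_smul, norm_mul]
        have h1 := hgb n x hx
        have h2 : ‖x i‖ ≤ 1 := (PiLp.norm_apply_le x i).trans hx1
        have h3 := (abs_nonneg _).trans h1
        exact mul_le_mul (mul_le_mul h1 h2 (norm_nonneg _) h3) hx1 (norm_nonneg _) (by linarith)
      · rw [norm_smul]
        simpa using hPb n x hx
    · simpa using (((hgx x hx).mul_const (x i)).smul_const x).add
        ((hPx x hx).smul_const (EuclideanSpace.single i (1 : ℝ)))
  intro δ hδ
  obtain ⟨n, hn0, hn1⟩ := ((hlim0.eventually_lt_const hδ).and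
    (eventually_all.2 fun i => (hlim1 i).eventually_lt_const hδ)).exists
  exact ⟨φ n, hφt n, hn0, hn1⟩

theorem RegularProfile.admissible {N : ℕ} {V q A : ℝ → ℝ} (h : RegularProfile N V q A) :
    Admissible (fun x : Space N => q ‖x‖ • x) :=
  ⟨h.memH1, h.memH10⟩

/-! ### Passage to the limit and minimality -/

theorem tendsto_integral_inner {α E : Type*} [MeasurableSpace α] {μ : Measure α}
    [NormedAddCommGroup E] [InnerProductSpace ℝ E] {F G : ℕ → α → E} {f g : α → E}
    (hF : ∀ n, MemLp (F n) 2 μ) (hG : ∀ n, MemLp (G n) 2 μ) (hf : MemLp f 2 μ) (hg : MemLp g 2 μ)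
    (hFf : Tendsto (fun n => eLpNorm (F n - f) 2 μ) atTop (𝓝 0))
    (hGg : Tendsto (fun n => eLpNorm (G n - g) 2 μ) atTop (𝓝 0)) :
    Tendsto (fun n => ∫ x, ⟪F n x, G n x⟫ ∂μ) atTop (𝓝 (∫ x, ⟪f x, g x⟫ ∂μ)) := by
  have h1 := (Lp.tendsto_Lp_iff_tendsto_eLpNorm'' F hF f hf).2 hFf
  have h2 := (Lp.tendsto_Lp_iff_tendsto_eLpNorm'' G hG g hg).2 hGg
  have e : ∀ {a b : α → E} (ha : MemLp a 2 μ) (hb : MemLp b 2 μ),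
      ⟪ha.toLp a, hb.toLp b⟫ = ∫ x, ⟪a x, b x⟫ ∂μ := by
    intro a b ha hb
    rw [L2.inner_def]
    refine integral_congr_ae ?_
    filter_upwards [ha.coeFn_toLp, hb.coeFn_toLp] with x hx hy
    rw [hx, hy]
  simpa only [e] using h1.inner (𝕜 := ℝ) h2

theorem IsTestMap.sub {N : ℕ} {φ ψ : Space N → Space N} (hφ : IsTestMap φ) (hψ : IsTestMap ψ) :
    IsTestMap (fun x => φ x - ψ x) :=
  ⟨hφ.1.sub hψ.1, hφ.2.1.sub hψ.2.1,
    (tsupport_sub φ ψ).trans (union_subset hφ.2.2 hψ.2.2)⟩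

theorem partialDeriv_sub {N : ℕ} {φ ψ : Space N → Space N} (hφ : IsTestMap φ)
    (hψ : IsTestMap ψ) (i : Fin N) (x : Space N) :
    partialDeriv i (fun x => φ x - ψ x) x = partialDeriv i φ x - partialDeriv i ψ x := by
  have h := ((hφ.1.differentiable (by simp) x).hasFDerivAt.sub
    (hψ.1.differentiable (by simp) x).hasFDerivAt).fderiv
  have e : fderiv ℝ (fun x => φ x - ψ x) x = _ := h
  rw [partialDeriv, e]
  rfl

theorem IsTestMap.memLp {N : ℕ} {φ : Space N → Space N} (hφ : IsTestMap φ) :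
    MemLp φ 2 (ballMeasure N) :=
  memLp_ball_of_continuous hφ.1.continuous 2

theorem IsTestMap.memLp_partialDeriv {N : ℕ} {φ : Space N → Space N} (hφ : IsTestMap φ)
    (i : Fin N) : MemLp (partialDeriv i φ) 2 (ballMeasure N) :=
  memLp_ball_of_continuous (hφ.continuous_partialDeriv i) 2

theorem Admissible.weakPartial_sub_id {N : ℕ} {u : Space N → Space N} (hu : Admissible u)
    (i : Fin N) : weakPartial i (fun x => u x - x) =ᵐ[ballMeasure N]
      fun x => weakPartial i u x - EuclideanSpace.single i (1 : ℝ) :=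
  hu.2.1.weakPartial_ae_eq ((hu.1.isWeakPartial i).sub hu.1.1
    (memLp_ball_of_continuous continuous_id 2) (isWeakPartial_id i))

theorem eLpNorm_sub_sub_le {N : ℕ} {a b a' b' F f : Space N → Space N}
    (ha : MemLp a 2 (ballMeasure N)) (hb : MemLp b 2 (ballMeasure N))
    (ha' : MemLp a' 2 (ballMeasure N)) (hb' : MemLp b' 2 (ballMeasure N))
    (h : (fun x => F x - f x) =ᵐ[ballMeasure N] fun x => (b x - b' x) - (a x - a' x)) :
    eLpNorm (F - f) 2 (ballMeasure N) ≤ eLpNorm (fun x => a x - a' x) 2 (ballMeasure N)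
      + eLpNorm (fun x => b x - b' x) 2 (ballMeasure N) := by
  have e : eLpNorm (F - f) 2 (ballMeasure N)
      = eLpNorm ((fun x => b x - b' x) - fun x => a x - a' x) 2 (ballMeasure N) :=
    eLpNorm_congr_ae h
  rw [e, add_comm]
  exact eLpNorm_sub_le (hb.sub hb').1 (ha.sub ha').1 (by norm_num)

/-- The difference of two admissible maps is approximated in `H¹` by test maps. -/
theorem Admissible.exists_approx_sub {N : ℕ} {u w : Space N → Space N} (hu : Admissible u)
    (hw : Admissible w) : ∃ φ : ℕ → Space N → Space N, (∀ n, IsTestMap (φ n)) ∧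
      Tendsto (fun n => eLpNorm (φ n - fun x => u x - w x) 2 (ballMeasure N)) atTop (𝓝 0) ∧
      ∀ i, Tendsto (fun n => eLpNorm (partialDeriv i (φ n) - fun x =>
        weakPartial i u x - weakPartial i w x) 2 (ballMeasure N)) atTop (𝓝 0) := by
  have hδ : ∀ n : ℕ, (0 : ℝ≥0∞) < ENNReal.ofReal (1 / ((n : ℝ) + 1)) := fun n =>
    ENNReal.ofReal_pos.2 (by positivity)
  choose φ hφ hφ0 hφ1 using fun n => hu.2.2 _ (hδ n)
  choose ψ hψ hψ0 hψ1 using fun n => hw.2.2 _ (hδ n)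
  have hlim : Tendsto (fun n : ℕ => ENNReal.ofReal (1 / ((n : ℝ) + 1)) +
      ENNReal.ofReal (1 / ((n : ℝ) + 1))) atTop (𝓝 0) := by
    have h1 := ENNReal.tendsto_ofReal (tendsto_one_div_add_atTop_nhds_zero_nat (𝕜 := ℝ))
    simpa using h1.add h1
  have hid : MemLp (fun x : Space N => x) 2 (ballMeasure N) :=
    memLp_ball_of_continuous continuous_id 2
  refine ⟨fun n x => φ n x - ψ n x, fun n => (hφ n).sub (hψ n), ?_, fun i => ?_⟩
  · refine tendsto_of_tendsto_of_tendsto_of_le_of_le tendsto_const_nhds hlim (fun _ => zero_le)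
      fun n => ?_
    refine (eLpNorm_sub_sub_le (hu.1.1.sub hid) (hw.1.1.sub hid) (hφ n).memLp (hψ n).memLp
      (Eventually.of_forall fun x => ?_)).trans (add_le_add (hφ0 n).le (hψ0 n).le)
    simp only [Pi.sub_apply]
    abel
  · refine tendsto_of_tendsto_of_tendsto_of_le_of_le tendsto_const_nhds hlim (fun _ => zero_le)
      fun n => ?_
    refine (eLpNorm_sub_sub_le (hu.2.1.isWeakPartial i).1 (hw.2.1.isWeakPartial i).1
      ((hφ n).memLp_partialDeriv i) ((hψ n).memLp_partialDeriv i) ?_).trans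
      (add_le_add (hφ1 n i).le (hψ1 n i).le)
    filter_upwards [hu.weakPartial_sub_id i, hw.weakPartial_sub_id i] with x hx hy
    rw [hx, hy, partialDeriv_sub (hφ n) (hψ n)]
    abel

theorem RegularProfile.weakPartial_ae_eq {N : ℕ} {V q A : ℝ → ℝ} (h : RegularProfile N V q A)
    (i : Fin N) : weakPartial i (fun x : Space N => q ‖x‖ • x) =ᵐ[ballMeasure N]
      radialPartial q A i :=
  h.memH1.weakPartial_ae_eq (h.isWeakPartial i)

theorem MemLp.integrable_inner {α E : Type*} [MeasurableSpace α] {μ : Measure α}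
    [NormedAddCommGroup E] [InnerProductSpace ℝ E] {f g : α → E}
    (hf : MemLp f 2 μ) (hg : MemLp g 2 μ) : Integrable (fun x => ⟪f x, g x⟫) μ := by
  refine (L2.integrable_inner (𝕜 := ℝ) (hf.toLp f) (hg.toLp g)).congr ?_
  filter_upwards [hf.coeFn_toLp, hg.coeFn_toLp] with x hx hy
  rw [hx, hy]

/-- Euler–Lagrange equation and coercivity for differences `u - q(|x|)x`, `u` admissible. -/
theorem RegularProfile.exists_second_variation_bound {N : ℕ} (hN : 7 ≤ N) {V q A : ℝ → ℝ}
    (h : RegularProfile N V q A) : ∃ κ > 0, ∀ u : Space N → Space N, Admissible u →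
      (∑ i, ∫ x in unitBall N, ⟪radialPartial q A i x, weakPartial i u x - radialPartial q A i x⟫
        = ∫ x in unitBall N, ⟪V ‖x‖ • q ‖x‖ • x, u x - q ‖x‖ • x⟫) ∧
      ∫ x in unitBall N, ⟪(V ‖x‖ + κ) • (u x - q ‖x‖ • x), u x - q ‖x‖ • x⟫
        ≤ ∑ i, ∫ x in unitBall N, ⟪weakPartial i u x - radialPartial q A i x,
            weakPartial i u x - radialPartial q A i x⟫ := by
  have hq := h.continuous_q
  have hA := h.continuous_A
  have hV := h.continuous_V
  obtain ⟨κ, hκ, hcoer⟩ := h.coercive hN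
  refine ⟨κ, hκ, fun u hu => ?_⟩
  obtain ⟨φ, hφ, hφ0, hφ1⟩ := hu.exists_approx_sub h.admissible
  have hrp : ∀ i : Fin N, MemLp (radialPartial q A i) 2 (ballMeasure N) := fun i =>
    memLp_ball_of_continuous (continuous_radialPartial hq hA i) 2
  have hv : MemLp (fun x => u x - q ‖x‖ • x) 2 (ballMeasure N) := hu.1.1.sub h.memH1.1
  have hd : ∀ i, MemLp (fun x => weakPartial i u x - radialPartial q A i x) 2 (ballMeasure N) :=
    fun i => (hu.1.isWeakPartial i).1.sub (hrp i)
  have hφ1' : ∀ i, Tendsto (fun n => eLpNorm (partialDeriv i (φ n) - fun x =>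
        weakPartial i u x - radialPartial q A i x) 2 (ballMeasure N)) atTop (𝓝 0) := by
    intro i
    refine (hφ1 i).congr fun n => eLpNorm_congr_ae ?_
    filter_upwards [h.weakPartial_ae_eq i] with x hx
    simp only [Pi.sub_apply, hx]
  have hconst : ∀ f : Space N → Space N,
      Tendsto (fun _ : ℕ => eLpNorm (f - f) 2 (ballMeasure N)) atTop (𝓝 0) := by
    intro f
    simp
  constructor
  · have hVu : MemLp (fun x : Space N => V ‖x‖ • q ‖x‖ • x) 2 (ballMeasure N) :=
      memLp_ball_of_continuous (by fun_prop) 2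
    -- Both sides of the equation for `φ n` converge, so the limits agree.
    have h1 := tendsto_finsetSum Finset.univ fun i _ =>
      tendsto_integral_inner (fun _ => hrp i) (fun n => (hφ n).memLp_partialDeriv i) (hrp i) (hd i)
        (hconst _) (hφ1' i)
    have h2 := tendsto_integral_inner (fun _ => hVu) (fun n => (hφ n).memLp) hVu hv
      (hconst _) hφ0
    refine tendsto_nhds_unique h1 (h2.congr fun n => ?_)
    rw [← h.euler_lagrange (hφ n)]
    exact integral_finsetSum _ fun i _ => MemLp.integrable_inner (hrp i)
      ((hφ n).memLp_partialDeriv i)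
  · have hc : Continuous fun x : Space N => V ‖x‖ + κ := by fun_prop
    obtain ⟨C, hC⟩ := (isCompact_closedBall (0 : Space N) 1).exists_bound_of_continuousOn
      hc.continuousOn
    have hcb : ∀ᵐ x ∂ballMeasure N, ‖V ‖x‖ + κ‖ ≤ C := by
      filter_upwards [ae_restrict_mem Metric.isOpen_ball.measurableSet] with x hx
      exact hC x (Metric.ball_subset_closedBall hx)
    have hsm : ∀ {f : Space N → Space N}, MemLp f 2 (ballMeasure N) →
        MemLp (fun x => (V ‖x‖ + κ) • f x) 2 (ballMeasure N) := by
      intro f hf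
      refine hf.of_le_mul (c := C) (hc.aestronglyMeasurable.smul hf.1) ?_
      filter_upwards [hcb] with x hx
      rw [norm_smul]
      gcongr
    have hw : Tendsto (fun n => eLpNorm ((fun x => (V ‖x‖ + κ) • φ n x) - fun x =>
        (V ‖x‖ + κ) • (u x - q ‖x‖ • x)) 2 (ballMeasure N)) atTop (𝓝 0) := by
      have h0 : Tendsto (fun n => ENNReal.ofReal C *
          eLpNorm (φ n - fun x => u x - q ‖x‖ • x) 2 (ballMeasure N)) atTop (𝓝 0) := by
        simpa using ENNReal.Tendsto.const_mul hφ0 (Or.inr ENNReal.ofReal_ne_top)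
      refine tendsto_of_tendsto_of_tendsto_of_le_of_le tendsto_const_nhds h0 (fun _ => zero_le)
        fun n => eLpNorm_le_mul_eLpNorm_of_ae_le_mul ?_ 2
      filter_upwards [hcb] with x hx
      simp only [Pi.sub_apply, ← smul_sub]
      rw [norm_smul]
      gcongr
    have h1 := tendsto_finsetSum Finset.univ fun i _ =>
      tendsto_integral_inner (fun n => (hφ n).memLp_partialDeriv i)
        (fun n => (hφ n).memLp_partialDeriv i) (hd i) (hd i) (hφ1' i) (hφ1' i)
    have h2 := tendsto_integral_inner (fun n => hsm (hφ n).memLp) (fun n => (hφ n).memLp) (hsm hv)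
      hv hw hφ0
    refine le_of_tendsto_of_tendsto' h2 h1 fun n => ?_
    rw [← integral_finsetSum _ fun i _ => MemLp.integrable_inner ((hφ n).memLp_partialDeriv i)
      ((hφ n).memLp_partialDeriv i)]
    simp only [real_inner_smul_left, real_inner_self_eq_norm_sq]
    exact hcoer (φ n) (hφ n)

/-! ### Energy comparison and uniqueness of the minimizer. -/

/-- The energy density of `x ↦ q(|x|) x`. -/
noncomputable def radialDensity {N : ℕ} (W : ℝ → ℝ) (ε : ℝ) (q A : ℝ → ℝ) (x : Space N) : ℝ :=
  1 / 2 * ∑ i : Fin N, ‖radialPartial q A i x‖ ^ 2 + 1 / (2 * ε ^ 2) * W (1 - ‖q ‖x‖ • x‖ ^ 2)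

theorem RegularProfile.integrable_radialDensity {N : ℕ} {V q A : ℝ → ℝ}
    (h : RegularProfile N V q A) {W : ℝ → ℝ} (hW : IsPotential W) (ε : ℝ) :
    Integrable (radialDensity W ε q A) (ballMeasure N) := by
  have hq := h.continuous_q
  have hr := fun i : Fin N => continuous_radialPartial hq h.continuous_A i
  have hWc : Continuous fun x : Space N => W (1 - ‖q ‖x‖ • x‖ ^ 2) :=
    hW.contDiffOn.continuousOn.comp_continuous (by fun_prop)
      fun x => mem_Iic.2 (sub_le_self _ (sq_nonneg _))
  refine integrableOn_ball_of_continuous ?_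
  exact (continuous_const.mul (continuous_finsetSum _ fun i _ => (hr i).norm.pow 2)).add
    (continuous_const.mul hWc)

theorem RegularProfile.energy_eq {N : ℕ} {V q A : ℝ → ℝ} (h : RegularProfile N V q A)
    {W : ℝ → ℝ} (hW : IsPotential W) (ε : ℝ) :
    energy W ε (fun x : Space N => q ‖x‖ • x)
      = ENNReal.ofReal (∫ x in unitBall N, radialDensity W ε q A x) := by
  rw [ofReal_integral_eq_lintegral_ofReal (h.integrable_radialDensity hW ε)]
  · refine lintegral_congr_ae ?_
    filter_upwards [ae_all_iff.2 h.weakPartial_ae_eq] with x hx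
    simp only [hx, radialDensity]
  · refine Eventually.of_forall fun x => ?_
    have h1 := hW.nonneg (sub_le_self (1 : ℝ) (sq_nonneg ‖q ‖x‖ • x‖))
    have h2 : 0 ≤ ∑ i : Fin N, ‖radialPartial q A i x‖ ^ 2 :=
      Finset.sum_nonneg fun i _ => sq_nonneg _
    simp only [Pi.zero_apply, radialDensity]
    positivity

/-- Allows comparison with an energy that may be infinite: only the minorant `f`, possibly of
changing sign, has to be integrable. -/
theorem ofReal_integral_le_lintegral {α : Type*} [MeasurableSpace α] {μ : Measure α} {f g : α → ℝ}
    (hf : Integrable f μ) (hfg : ∀ᵐ x ∂μ, f x ≤ g x) :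
    ENNReal.ofReal (∫ x, f x ∂μ) ≤ ∫⁻ x, ENNReal.ofReal (g x) ∂μ := by
  calc ENNReal.ofReal (∫ x, f x ∂μ) ≤ ENNReal.ofReal (∫ x, max (f x) 0 ∂μ) :=
        ENNReal.ofReal_le_ofReal (integral_mono hf hf.pos_part fun x => le_max_left _ _)
    _ = ∫⁻ x, ENNReal.ofReal (max (f x) 0) ∂μ :=
        ofReal_integral_eq_lintegral_ofReal hf.pos_part
          (Eventually.of_forall fun x => le_max_right _ _)
    _ ≤ _ := by
        refine lintegral_mono_ae ?_
        filter_upwards [hfg] with x hx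
        rw [ENNReal.ofReal_max, ENNReal.ofReal_zero, max_eq_left zero_le]
        exact ENNReal.ofReal_le_ofReal hx

/-- A quantitative gap: the `L²` distance to the radial map is controlled by the energy excess, so
minimality and uniqueness come together. -/
theorem RegularProfile.exists_energy_bound {N : ℕ} (hN : 7 ≤ N) {V q A : ℝ → ℝ}
    (h : RegularProfile N V q A) {W : ℝ → ℝ} (hW : IsPotential W) {ε : ℝ}
    (hV : ∀ r ∈ Icc (0 : ℝ) 1, V r = 1 / ε ^ 2 * derivWithin W (Iic 1) (1 - (r * q r) ^ 2)) :
    ∃ κ > 0, ∀ u : Space N → Space N, Admissible u →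
      ENNReal.ofReal ((∫ x in unitBall N, radialDensity W ε q A x)
        + κ * ∫ x in unitBall N, ‖u x - q ‖x‖ • x‖ ^ 2) ≤ energy W ε u := by
  have hq := h.continuous_q
  have hA := h.continuous_A
  have hVc := h.continuous_V
  obtain ⟨κ, hκ, hκu⟩ := h.exists_second_variation_bound hN
  refine ⟨κ / 2, by positivity, fun u hu => ?_⟩
  obtain ⟨hEL, hco⟩ := hκu u hu
  have hrp : ∀ i : Fin N, MemLp (radialPartial q A i) 2 (ballMeasure N) := fun i =>
    memLp_ball_of_continuous (continuous_radialPartial hq hA i) 2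
  have hv : MemLp (fun x => u x - q ‖x‖ • x) 2 (ballMeasure N) := hu.1.1.sub h.memH1.1
  have hd : ∀ i, MemLp (fun x => weakPartial i u x - radialPartial q A i x) 2 (ballMeasure N) :=
    fun i => (hu.1.isWeakPartial i).1.sub (hrp i)
  have hVu : MemLp (fun x : Space N => V ‖x‖ • q ‖x‖ • x) 2 (ballMeasure N) :=
    memLp_ball_of_continuous (by fun_prop) 2
  have hVv : Integrable (fun x => (V ‖x‖ + κ) * ‖u x - q ‖x‖ • x‖ ^ 2) (ballMeasure N) := by
    have hc : Continuous fun x : Space N => V ‖x‖ + κ := by fun_prop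
    obtain ⟨C, hC⟩ := (isCompact_closedBall (0 : Space N) 1).exists_bound_of_continuousOn
      hc.continuousOn
    refine Integrable.bdd_mul (c := C) (hv.integrable_norm_pow two_ne_zero)
      hc.aestronglyMeasurable ?_
    filter_upwards [ae_restrict_mem Metric.isOpen_ball.measurableSet] with x hx
    exact hC x (Metric.ball_subset_closedBall hx)
  have hvv : Integrable (fun x => ‖u x - q ‖x‖ • x‖ ^ 2) (ballMeasure N) :=
    hv.integrable_norm_pow two_ne_zero
  have i1 := h.integrable_radialDensity hW ε
  have i2 : Integrable (fun x => ∑ i, ⟪radialPartial q A i x,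
      weakPartial i u x - radialPartial q A i x⟫) (ballMeasure N) :=
    integrable_finsetSum _ fun i _ => MemLp.integrable_inner (hrp i) (hd i)
  have i3 : Integrable (fun x => ⟪V ‖x‖ • q ‖x‖ • x, u x - q ‖x‖ • x⟫) (ballMeasure N) :=
    MemLp.integrable_inner hVu hv
  have i4 : Integrable (fun x => ∑ i, ⟪weakPartial i u x - radialPartial q A i x,
      weakPartial i u x - radialPartial q A i x⟫) (ballMeasure N) :=
    integrable_finsetSum _ fun i _ => MemLp.integrable_inner (hd i) (hd i)
  rw [← integral_finsetSum _ fun i _ => MemLp.integrable_inner (hrp i) (hd i)] at hEL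
  rw [← integral_finsetSum _ fun i _ => MemLp.integrable_inner (hd i) (hd i)] at hco
  simp only [real_inner_smul_left _ (u _ - _), real_inner_self_eq_norm_sq (u _ - _)] at hco
  -- Integrable minorant of the energy density of `u`, grouped so that the first correction
  -- integrates to 0 (Euler–Lagrange) and the second to at least 0 (coercivity).
  set G : Space N → ℝ := fun x => (radialDensity W ε q A x
      + (∑ i, ⟪radialPartial q A i x, weakPartial i u x - radialPartial q A i x⟫
        - ⟪V ‖x‖ • q ‖x‖ • x, u x - q ‖x‖ • x⟫))
      + (1 / 2 * (∑ i, ⟪weakPartial i u x - radialPartial q A i x,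
          weakPartial i u x - radialPartial q A i x⟫ - (V ‖x‖ + κ) * ‖u x - q ‖x‖ • x‖ ^ 2)
        + κ / 2 * ‖u x - q ‖x‖ • x‖ ^ 2) with hG
  have i23 : Integrable (fun x => ∑ i, ⟪radialPartial q A i x,
      weakPartial i u x - radialPartial q A i x⟫
        - ⟪V ‖x‖ • q ‖x‖ • x, u x - q ‖x‖ • x⟫) (ballMeasure N) := i2.sub i3
  have i123 : Integrable (fun x => radialDensity W ε q A x + (∑ i, ⟪radialPartial q A i x,
      weakPartial i u x - radialPartial q A i x⟫
        - ⟪V ‖x‖ • q ‖x‖ • x, u x - q ‖x‖ • x⟫)) (ballMeasure N) := i1.add i23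
  have i4V : Integrable (fun x => 1 / 2 * (∑ i, ⟪weakPartial i u x - radialPartial q A i x,
      weakPartial i u x - radialPartial q A i x⟫ - (V ‖x‖ + κ) * ‖u x - q ‖x‖ • x‖ ^ 2))
      (ballMeasure N) := (i4.sub hVv).const_mul _
  have i5 : Integrable (fun x => κ / 2 * ‖u x - q ‖x‖ • x‖ ^ 2) (ballMeasure N) := hvv.const_mul _
  have i45 : Integrable (fun x => 1 / 2 * (∑ i, ⟪weakPartial i u x - radialPartial q A i x,
      weakPartial i u x - radialPartial q A i x⟫ - (V ‖x‖ + κ) * ‖u x - q ‖x‖ • x‖ ^ 2)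
        + κ / 2 * ‖u x - q ‖x‖ • x‖ ^ 2) (ballMeasure N) := i4V.add i5
  have hGi : Integrable G (ballMeasure N) := i123.add i45
  have hGint : (∫ x in unitBall N, radialDensity W ε q A x)
      + κ / 2 * (∫ x in unitBall N, ‖u x - q ‖x‖ • x‖ ^ 2) ≤ ∫ x in unitBall N, G x := by
    rw [hG, integral_add i123 i45, integral_add i1 i23, integral_sub i2 i3, hEL, sub_self, add_zero,
      integral_add i4V i5, integral_const_mul, integral_const_mul, integral_sub i4 hVv]
    linarith
  refine (ENNReal.ofReal_le_ofReal hGint).trans (ofReal_integral_le_lintegral hGi ?_)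
  filter_upwards [ae_restrict_mem Metric.isOpen_ball.measurableSet] with x hx
  have hx1 : ‖x‖ < 1 := by simpa using hx
  have hqx : ‖q ‖x‖ • x‖ ^ 2 = (‖x‖ * q ‖x‖) ^ 2 := by
    rw [norm_smul, mul_pow, Real.norm_eq_abs, sq_abs]; ring
  have hW' := hW.tangent_le (s := 1 - ‖u x‖ ^ 2) (t := 1 - ‖q ‖x‖ • x‖ ^ 2)
    (sub_le_self _ (sq_nonneg _)) (sub_le_self _ (sq_nonneg _))
  have hVx := hV ‖x‖ ⟨norm_nonneg x, hx1.le⟩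
  rw [← hqx] at hVx
  have hux : ‖u x‖ ^ 2 = ‖q ‖x‖ • x‖ ^ 2 + 2 * ⟪q ‖x‖ • x, u x - q ‖x‖ • x⟫
      + ‖u x - q ‖x‖ • x‖ ^ 2 := by
    rw [← norm_add_sq_real]; simp
  have hsum : ∑ i, ‖weakPartial i u x‖ ^ 2 = ∑ i, ‖radialPartial q A i x‖ ^ 2
      + 2 * ∑ i, ⟪radialPartial q A i x, weakPartial i u x - radialPartial q A i x⟫
      + ∑ i, ⟪weakPartial i u x - radialPartial q A i x,
          weakPartial i u x - radialPartial q A i x⟫ := by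
    rw [Finset.mul_sum, ← Finset.sum_add_distrib, ← Finset.sum_add_distrib]
    refine Finset.sum_congr rfl fun i _ => ?_
    rw [real_inner_self_eq_norm_sq, ← norm_add_sq_real]; simp
  -- Tangent line of `W` at `1 - |U|²`; the increment is `-(2⟨U, v⟩ + |v|²)`, and `W'/(2ε²) = V/2`.
  have hpot : 1 / (2 * ε ^ 2) * W (1 - ‖q ‖x‖ • x‖ ^ 2) - V ‖x‖ * ⟪q ‖x‖ • x, u x - q ‖x‖ • x⟫
      - 1 / 2 * V ‖x‖ * ‖u x - q ‖x‖ • x‖ ^ 2 ≤ 1 / (2 * ε ^ 2) * W (1 - ‖u x‖ ^ 2) := by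
    have h1 := mul_le_mul_of_nonneg_left hW' (show 0 ≤ 1 / (2 * ε ^ 2) by positivity)
    refine le_trans (le_of_eq ?_) h1
    rw [hVx, hux]
    ring
  simp only [hG, radialDensity, hsum, real_inner_smul_left (q ‖x‖ • x)]
  linarith

theorem radialMap_eq {N : ℕ} (q : ℝ → ℝ) :
    (radialMap (fun r => r * q r) : Space N → Space N) = fun x => q ‖x‖ • x := by
  ext1 x
  rcases eq_or_ne x 0 with rfl | hx
  · simp [radialMap]
  · have : ‖x‖ ≠ 0 := norm_ne_zero_iff.2 hx
    rw [radialMap, mul_div_cancel_left₀ _ this]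

theorem RegularProfile.isGlobalMinimizer {N : ℕ} (hN : 7 ≤ N) {V q A : ℝ → ℝ}
    (h : RegularProfile N V q A) {W : ℝ → ℝ} (hW : IsPotential W) {ε : ℝ}
    (hV : ∀ r ∈ Icc (0 : ℝ) 1, V r = 1 / ε ^ 2 * derivWithin W (Iic 1) (1 - (r * q r) ^ 2)) :
    IsGlobalMinimizer W ε (fun x : Space N => q ‖x‖ • x) ∧
      ∀ u : Space N → Space N, IsGlobalMinimizer W ε u →
        u =ᵐ[ballMeasure N] fun x => q ‖x‖ • x := by
  obtain ⟨κ, hκ, hbound⟩ := h.exists_energy_bound hN hW hV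
  have hnn : ∀ u : Space N → Space N, 0 ≤ ∫ x in unitBall N, ‖u x - q ‖x‖ • x‖ ^ 2 := fun u =>
    integral_nonneg fun x => sq_nonneg _
  refine ⟨⟨h.admissible, fun u hu => ?_⟩, fun u hu => ?_⟩
  · rw [h.energy_eq hW]
    refine (ENNReal.ofReal_le_ofReal ?_).trans (hbound u hu)
    exact le_add_of_nonneg_right (mul_nonneg hκ.le (hnn u))
  · have h1 := (hbound u hu.1).trans (hu.2 _ h.admissible)
    rw [h.energy_eq hW] at h1
    -- `ENNReal.ofReal` truncates negative numbers, so this sign is needed to read the comparison as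
    -- one between reals.
    have hE : 0 ≤ ∫ x in unitBall N, radialDensity W ε q A x := integral_nonneg fun x => by
      have h1 := hW.nonneg (sub_le_self (1 : ℝ) (sq_nonneg ‖q ‖x‖ • x‖))
      have h2 : 0 ≤ ∑ i : Fin N, ‖radialPartial q A i x‖ ^ 2 :=
        Finset.sum_nonneg fun i _ => sq_nonneg _
      simp only [Pi.zero_apply, radialDensity]
      positivity
    rw [ENNReal.ofReal_le_ofReal_iff hE] at h1
    have h2 : ∫ x in unitBall N, ‖u x - q ‖x‖ • x‖ ^ 2 = 0 := by
      refine le_antisymm ?_ (hnn u)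
      by_contra! hpos
      have := mul_pos hκ hpos
      linarith
    have hv : MemLp (fun x => u x - q ‖x‖ • x) 2 (ballMeasure N) := hu.1.1.1.sub h.memH1.1
    rw [integral_eq_zero_iff_of_nonneg (fun x => sq_nonneg _)
      (hv.integrable_norm_pow two_ne_zero)] at h2
    filter_upwards [h2] with x hx
    simpa [sub_eq_zero] using hx

end GinzburgLandau

theorem theorem1 (N : ℕ) (hN : 7 ≤ N) (W : ℝ → ℝ) (hW : GinzburgLandau.IsPotential W)
    (ε : ℝ) (hε : 0 < ε) :
    ∃ f : ℝ → ℝ,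
      GinzburgLandau.IsRadialProfile N W ε f ∧
      (∀ g : ℝ → ℝ, GinzburgLandau.IsRadialProfile N W ε g → EqOn g f (Icc 0 1)) ∧
      (∀ r ∈ Ioo (0 : ℝ) 1, 0 < f r) ∧
      StrictMonoOn f (Icc 0 1) ∧
      GinzburgLandau.IsGlobalMinimizer W ε
        (GinzburgLandau.radialMap f : GinzburgLandau.Space N → GinzburgLandau.Space N) ∧
      ∀ u : GinzburgLandau.Space N → GinzburgLandau.Space N,
        GinzburgLandau.IsGlobalMinimizer W ε u →
          u =ᵐ[GinzburgLandau.ballMeasure N] GinzburgLandau.radialMap f := by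
  have hN3 : 3 ≤ N := by omega
  obtain ⟨q, A, V, hreg, hV, hprof, hmono⟩ :=
    GinzburgLandau.exists_regularProfile hN3 hW (ε := ε)
  have hpos : ∀ r ∈ Ioo (0 : ℝ) 1, 0 < r * q r := fun r hr =>
    mul_pos hr.1 (zero_lt_one.trans_le (hreg.one_le r))
  obtain ⟨hmin, huniq⟩ := hreg.isGlobalMinimizer hN hW hV
  refine ⟨fun r => r * q r, hprof, fun g hg => hprof.eqOn hN3 hW hg hpos, hpos, hmono, ?_, ?_⟩
  · rw [GinzburgLandau.radialMap_eq]; exact hmin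
  · rw [GinzburgLandau.radialMap_eq]; exact huniq
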